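/- **Notation.** A code $C \le \mathbb{F}_2^r$ is a linear subspace; $\rho(C) = \dim(C)/r$ is its rate and $\delta(C) = \frac1r \min\{\mathrm{wt}(c) : 0 \neq c \in C\}$ its normalized distance, where $\mathrm{wt}$ is the Hamming weight. Regard $\mathbb{F}_2^r\otimes\mathbb{F}_2^r$ as the space of $r\times r$ matrices over $\mathbb{F}_2$. Then $\mathbb{F}_2^r\otimes C$ (resp. $C\otimes \mathbb{F}_2^r$) consists of the matrices all of whose rows (resp. columns) lie in $C$, and $C\otimes C$ is their intersection. For matrices $f,g$ let $d(f,g)$, $d_{row}(f,g)$, $d_{col}(f,g)$ be the fractions of entries, of rows and of columns, respectively, in which $f$ and $g$ differ, and put $$d_{rc}\big((f,g),C\otimes C\big) = \tfrac12 \min_{w\in C\otimes C}\big(d_{row}(f,w)+d_{col}(g,w)\big).$$ The agreement testability parameter of the tensor code of $C \neq 0$ is $$\sigma(C) = \min\left\{ \frac{d(f,g)}{d_{rc}\big((f,g),C\otimes C\big)} \;:\; f\in\mathbb{F}_2^r\otimes C,\ g\in C\otimes\mathbb{F}_2^r,\ f\ne g\right\}.$$ A family of codes $\{C_i\le\mathbb{F}_2^{r_i}\}_{i\in\mathbb{N}}$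 is *explicitly constructed* if there are a deterministic Turing machine and a polynomial $T$ such that for every $i$ the machine, given $i$ in unary, outputs a parity-check matrix of $C_i$ (a matrix over $\mathbb{F}_2$ whose kernel is $C_i$) within $T(r_i)$ steps. **Proposition 3.7.** For every $\epsilon>0$ there exist $\delta_1,\sigma_1>0$ and an infinite, explicitly constructed family of nonzero codes $\{C_i\le\mathbb{F}_2^{r_i}\}_{i \in \mathbb{N}}$, of even lengths $r_i$ with $r_i\to\infty$, such that for every $i$ $$\rho(C_i)\ge 1-\epsilon,\qquad \delta(C_i)\ge\delta_1\qquad\text{and}\qquad \sigma(C_i)\ge\sigma_1 .$$ -/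

import Mathlib

namespace BaseCode

/-- A binary linear code of length `r`: a linear subspace of `𝔽₂ʳ`. -/
abbrev LinearCode (r : ℕ) : Type := Submodule (ZMod 2) (Fin r → ZMod 2)

/-- The rate `dim C / r`. -/
noncomputable def rate {r : ℕ} (C : LinearCode r) : ℝ :=
  (Module.finrank (ZMod 2) C : ℝ) / (r : ℝ)

/-- The minimum Hamming weight of a nonzero codeword. The minimum is attained as soon as
`C ≠ 0`; for `C = 0` the value is `0`. -/
noncomputable def minDist {r : ℕ} (C : LinearCode r) : ℕ :=
  sInf {w : ℕ | ∃ c ∈ C, c ≠ 0 ∧ hammingNorm c = w}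

/-- The normalized distance. It is positive only for nonzero codes. -/
noncomputable def normDist {r : ℕ} (C : LinearCode r) : ℝ :=
  (minDist C : ℝ) / (r : ℝ)

/-- `𝔽₂ʳ ⊗ C`: the matrices all of whose rows `f(v, ·)` lie in `C`. -/
def rowCode {r : ℕ} (C : LinearCode r) : Set (Matrix (Fin r) (Fin r) (ZMod 2)) :=
  {f | ∀ v, f.row v ∈ C}

/-- `C ⊗ 𝔽₂ʳ`: the matrices all of whose columns `g(·, u)` lie in `C`. -/
def colCode {r : ℕ} (C : LinearCode r) : Set (Matrix (Fin r) (Fin r) (ZMod 2)) :=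
  {g | ∀ u, g.col u ∈ C}

/-- The tensor code `C ⊗ C`: the matrices all of whose rows and columns lie in `C`. -/
def tensorCode {r : ℕ} (C : LinearCode r) : Set (Matrix (Fin r) (Fin r) (ZMod 2)) :=
  rowCode C ∩ colCode C

/-- The fraction of entries in which `f` and `g` differ. -/
noncomputable def entryDist {r : ℕ} (f g : Matrix (Fin r) (Fin r) (ZMod 2)) : ℝ :=
  ((Finset.univ.filter fun p : Fin r × Fin r => f p.1 p.2 ≠ g p.1 p.2).card : ℝ) / (r : ℝ) ^ 2

/-- The fraction of rows in which `f` and `g` differ. -/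
noncomputable def rowDist {r : ℕ} (f g : Matrix (Fin r) (Fin r) (ZMod 2)) : ℝ :=
  ((Finset.univ.filter fun v : Fin r => f.row v ≠ g.row v).card : ℝ) / (r : ℝ)

/-- The fraction of columns in which `f` and `g` differ. -/
noncomputable def colDist {r : ℕ} (f g : Matrix (Fin r) (Fin r) (ZMod 2)) : ℝ :=
  ((Finset.univ.filter fun u : Fin r => f.col u ≠ g.col u).card : ℝ) / (r : ℝ)

/-- The row-column distance of the pair `(f, g)` from the tensor code: half of the minimum of
`rowDist f w + colDist g w` over `w ∈ C ⊗ C` (a minimum over a finite set that contains `0`). -/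
noncomputable def rowColDist {r : ℕ} (C : LinearCode r)
    (f g : Matrix (Fin r) (Fin r) (ZMod 2)) : ℝ :=
  (1 / 2) * sInf ((fun w => rowDist f w + colDist g w) '' tensorCode C)

/-- The agreement testability parameter of the tensor code of `C`: the minimum of
`entryDist f g / rowColDist C f g` over `f ∈ 𝔽₂ʳ ⊗ C` and `g ∈ C ⊗ 𝔽₂ʳ` with `f ≠ g`.
The denominator is positive for every such pair, and for `C ≠ 0` the set of values is finite
and nonempty, so the minimum is attained. -/
noncomputable def agreementTestability {r : ℕ} (C : LinearCode r) : ℝ :=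
  sInf {x : ℝ | ∃ f ∈ rowCode C, ∃ g ∈ colCode C, f ≠ g ∧
    x = entryDist f g / rowColDist C f g}

/-- A binary matrix as a word over the alphabet `{0, 1, separator}`: its rows, one after the
other, each followed by the separator `none`. -/
def matrixWord {m n : ℕ} (H : Matrix (Fin m) (Fin n) (ZMod 2)) : List (Option (ZMod 2)) :=
  (List.ofFn fun j : Fin m => List.ofFn (fun k : Fin n => some (H j k)) ++ [none]).flatten

/-- A family of codes `C i` of lengths `r i` is explicitly constructed if there is one
(deterministic, multi-stack) Turing machine that, given the index `i` in unary, writes down a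
parity-check matrix of `C i` and halts within a number of steps that is polynomial in `r i`. -/
def ExplicitlyConstructed (r : ℕ → ℕ) (C : ∀ i, LinearCode (r i)) : Prop :=
  ∃ (m : ℕ → ℕ) (H : ∀ i, Matrix (Fin (m i)) (Fin (r i)) (ZMod 2)),
    (∀ i x, x ∈ C i ↔ (H i).mulVec x = 0) ∧
    ∃ (M : Turing.TM2ComputableAux Unit (Option (ZMod 2))) (T : Polynomial ℕ),
      ∀ i, Nonempty (Turing.TM2OutputsInTime M.tm
        ((List.replicate i ()).map M.inputAlphabet.symm)
        (some ((matrixWord (H i)).map M.outputAlphabet.symm))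
        (T.eval (r i)))

end BaseCode

/-! ### A small imperative language over unary registers, compiled to multi-stack machines -/

/-! The codes are Tanner codes of expanders of constant degree. Both vertex sides are copies of the
torus `(ℤ/N)²`; for each word `w` of length `t` in six generating maps an edge joins `p` on the left
to `w p` on the right. Bits sit on the edges, and the `6 ^ t` bits around every vertex must form a
word of one fixed inner code.

Testability comes from smoothness (`IsSmooth`): when all checks touching a small coordinate set `A`
are dropped, the words of small weight that satisfy the remaining checks live on a set of size
`O(#A)`. For `f` with rows and `g` with columns in the code, `E = f - g` is annihilated by every
check in the row direction combined with every check in the column direction. If `E` is sparse, few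
rows and columns are heavy. Erasing them and using smoothness once in each direction shows that `E`
vanishes off few rows and few columns (`IsSmooth.exists_support`); low density keeps the product of
`E` with a check light. These rows and columns are too few to carry a nonzero codeword, so `f` and
`g` come from a common tensor codeword (`exists_tensorCode_of_agree`). Smoothness with `A = ∅` is
the distance bound.

Tanner codes are smooth by expander mixing. The ends of the edges in `A` are enlarged to a pair of
vertex sets into which no outside vertex sends many edges (`exists_closed_pair`). A sparse word not
confined to this pair would have large degree at all its outside vertices, hence span too dense a
subgraph (`exists_superset_of_expanding`).

Expansion is of Margulis type. The Fourier transform turns translations into multiplication by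
characters and shears into dual shears. A nearly invariant function of mean zero would have a nearly
shear-invariant spectral measure, concentrated around the origin but without an atom there, which
the action of the shears on sectors excludes (`sum_le_of_shear_invariant`). Words of length `t` then
contract by `μ ^ t` with an absolute `μ < 1`. The inner code needs relative distance only about `4 *
μ ^ t`, which costs `O(t * μ ^ t * 6 ^ t)` checks by Gilbert–Varshamov, a vanishing fraction of `6 ^
t`; hence the rate.

For explicitness, a fixed register program prints the check matrix and is compiled to a multi-stack
machine without loss of time. -/

namespace StackProgram

open Turing

/-- Programs over `n` unary registers and an output stack over `α`. -/
inductive Prog (α : Type) (n : ℕ) : Type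
  | skip : Prog α n
  | inc (k : Fin n) : Prog α n
  | dec (k : Fin n) : Prog α n
  | emit (a : α) : Prog α n
  | seq (p q : Prog α n) : Prog α n
  | loop (k : Fin n) (p : Prog α n) : Prog α n
  | ifz (k : Fin n) (p q : Prog α n) : Prog α n

/-- The contents of the registers and of the output stack. -/
@[ext] structure St (α : Type) (n : ℕ) where
  reg : Fin n → ℕ
  out : List α

variable {α : Type} {n : ℕ}

/-- `Exec p s t s'`: the program `p`, started in `s`, ends in `s'` after `t` steps. -/
inductive Exec : Prog α n → St α n → ℕ → St α n → Prop
  | skip (s) : Exec .skip s 1 s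
  | inc (k s) : Exec (.inc k) s 1 ⟨Function.update s.reg k (s.reg k + 1), s.out⟩
  | dec (k s) : Exec (.dec k) s 1 ⟨Function.update s.reg k (s.reg k - 1), s.out⟩
  | emit (a s) : Exec (.emit a) s 1 ⟨s.reg, a :: s.out⟩
  | seq {p q s s' s'' a b} : Exec p s a s' → Exec q s' b s'' → Exec (.seq p q) s (a + b) s''
  | loop_zero {k p s} : s.reg k = 0 → Exec (.loop k p) s 1 s
  | loop_succ {k p s s' s'' a b} : s.reg k ≠ 0 → Exec p s a s' → Exec (.loop k p) s' b s'' →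
      Exec (.loop k p) s (1 + a + b) s''
  | ifz_zero {k p q s s' a} : s.reg k = 0 → Exec p s a s' → Exec (.ifz k p q) s (1 + a) s'
  | ifz_succ {k p q s s' a} : s.reg k ≠ 0 → Exec q s a s' → Exec (.ifz k p q) s (1 + a) s'

/-- The labels of the machine code of a program. -/
def Label : Prog α n → Type
  | .skip => Unit
  | .inc _ => Unit
  | .dec _ => Unit
  | .emit _ => Unit
  | .seq p q => Label p ⊕ Label q
  | .loop _ p => Option (Label p)
  | .ifz _ p q => Option (Label p ⊕ Label q)

theorem finite_label : ∀ p : Prog α n, Finite (Label p)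
  | .skip => inferInstanceAs (Finite Unit)
  | .inc _ => inferInstanceAs (Finite Unit)
  | .dec _ => inferInstanceAs (Finite Unit)
  | .emit _ => inferInstanceAs (Finite Unit)
  | .seq p q =>
    haveI := finite_label p
    haveI := finite_label q
    inferInstanceAs (Finite (Label p ⊕ Label q))
  | .loop _ p =>
    haveI := finite_label p
    inferInstanceAs (Finite (Option (Label p)))
  | .ifz _ p q =>
    haveI := finite_label p
    haveI := finite_label q
    inferInstanceAs (Finite (Option (Label p ⊕ Label q)))

/-- The label at which a program starts. -/
def entry : ∀ p : Prog α n, Label p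
  | .skip => ()
  | .inc _ => ()
  | .dec _ => ()
  | .emit _ => ()
  | .seq p _ => Sum.inl (entry p)
  | .loop _ _ => none
  | .ifz _ _ _ => none

/-- The stack alphabets: `α` for the output stack, one symbol for each register. -/
def Alph (α : Type) (n : ℕ) : Option (Fin n) → Type
  | none => α
  | some _ => Unit

/-- The stack contents that represent a state. -/
def tapes (s : St α n) : ∀ k, List (Alph α n k)
  | none => s.out
  | some k => List.replicate (s.reg k) ()

/-- Jump to `a` if register `k` is zero, to `b` otherwise. -/
def test {Λ : Type} (k : Fin n) (a b : Λ) : TM2.Stmt (Alph α n) Λ Bool :=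
  .peek (some k) (fun _ o => o.isSome) (.branch id
    (.load (fun _ => false) (.goto fun _ => b)) (.load (fun _ => false) (.goto fun _ => a)))

/-- The machine code of a program whose labels are embedded by `emb`, continuing at `ex`. -/
def code {Λ : Type} : ∀ p : Prog α n, (Label p → Λ) → Λ → Label p → TM2.Stmt (Alph α n) Λ Bool
  | .skip, _, ex, _ => .goto fun _ => ex
  | .inc k, _, ex, _ => .push (some k) (fun _ => ()) (.goto fun _ => ex)
  | .dec k, _, ex, _ => .pop (some k) (fun v _ => v) (.goto fun _ => ex)
  | .emit a, _, ex, _ => .push none (fun _ => a) (.goto fun _ => ex)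
  | .seq p q, emb, ex, l =>
    match l with
    | .inl l => code p (emb ∘ Sum.inl) (emb (Sum.inr (entry q))) l
    | .inr l => code q (emb ∘ Sum.inr) ex l
  | .loop k p, emb, ex, l =>
    match l with
    | none => test k ex (emb (some (entry p)))
    | some l => code p (emb ∘ some) (emb none) l
  | .ifz k p q, emb, ex, l =>
    match l with
    | none => test k (emb (some (Sum.inl (entry p)))) (emb (some (Sum.inr (entry q))))
    | some (.inl l) => code p (emb ∘ some ∘ Sum.inl) ex l
    | some (.inr l) => code q (emb ∘ some ∘ Sum.inr) ex l

/-- The configuration at label `l` in state `s`. -/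
def config {Λ : Type} (l : Λ) (s : St α n) : TM2.Cfg (Alph α n) Λ Bool := ⟨some l, false, tapes s⟩

/-- `t` steps lead from `c` to `c'`. -/
def Steps {Λ : Type} (M : Λ → TM2.Stmt (Alph α n) Λ Bool) (t : ℕ)
    (c c' : TM2.Cfg (Alph α n) Λ Bool) : Prop :=
  (flip bind (TM2.step M))^[t] (some c) = some c'

theorem Steps.trans {Λ : Type} {M : Λ → TM2.Stmt (Alph α n) Λ Bool} {a b : ℕ}
    {c c' c'' : TM2.Cfg (Alph α n) Λ Bool} (h : Steps M a c c') (h' : Steps M b c' c'') :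
    Steps M (a + b) c c'' := by
  unfold Steps at *
  rw [add_comm, Function.iterate_add_apply, h, h']

theorem tapes_update_some (s : St α n) (k : Fin n) (v : ℕ) :
    Function.update (tapes s) (some k) (List.replicate v ()) =
      tapes ⟨Function.update s.reg k v, s.out⟩ := by
  funext j
  rcases j with _ | j
  · rfl
  · by_cases h : j = k
    · subst h
      simp [tapes]
    · rw [Function.update_of_ne (by simpa using h)]
      simp [tapes, Function.update_of_ne h]

theorem tapes_update_none (s : St α n) (l : List α) :
    Function.update (tapes s) none l = tapes ⟨s.reg, l⟩ := by
  funext j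
  rcases j with _ | j
  · exact Function.update_self ..
  · rfl

theorem steps_test_zero {Λ : Type} {M : Λ → TM2.Stmt (Alph α n) Λ Bool} {l a b : Λ} {k : Fin n}
    (hM : M l = test k a b) {s : St α n} (hs : s.reg k = 0) :
    Steps M 1 (config l s) (config a s) := by
  simp [Steps, flip, config, hM, test, tapes, hs]

theorem steps_test_succ {Λ : Type} {M : Λ → TM2.Stmt (Alph α n) Λ Bool} {l a b : Λ} {k : Fin n}
    (hM : M l = test k a b) {s : St α n} (hs : s.reg k ≠ 0) :
    Steps M 1 (config l s) (config b s) := by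
  obtain ⟨v, hv⟩ := Nat.exists_eq_succ_of_ne_zero hs
  simp [Steps, flip, config, hM, test, tapes, hv]
  rfl

/-- Induction on the execution. The embedding and the exit label stay general, so that the code of a
subprogram may sit anywhere in a larger machine. Step counts agree exactly: sequencing is free,
since the first part exits directly to the entry of the second. -/
theorem Exec.steps {Λ : Type} {M : Λ → TM2.Stmt (Alph α n) Λ Bool} {p : Prog α n} {s s' : St α n}
    {t : ℕ} (h : Exec p s t s') : ∀ (emb : Label p → Λ) (ex : Λ),
      (∀ l, M (emb l) = code p emb ex l) → Steps M t (config (emb (entry p)) s) (config ex s') := by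
  induction h with
  | skip s => intro emb ex hM; simp [Steps, flip, config, hM, code]
  | inc k s =>
    intro emb ex hM
    simp only [Steps, flip, config, hM, code, Function.iterate_one, Option.bind_eq_bind,
      Option.bind_some, TM2.step, TM2.stepAux]
    rw [← tapes_update_some]
    rfl
  | dec k s =>
    intro emb ex hM
    simp only [Steps, flip, config, hM, code, Function.iterate_one, Option.bind_eq_bind,
      Option.bind_some, TM2.step, TM2.stepAux]
    rw [← tapes_update_some]
    simp only [tapes]
    cases s.reg k <;> rfl
  | emit a s =>
    intro emb ex hM
    simp only [Steps, flip, config, hM, code, Function.iterate_one, Option.bind_eq_bind,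
      Option.bind_some, TM2.step, TM2.stepAux]
    exact congrArg (fun S => some (TM2.Cfg.mk (some ex) false S)) (tapes_update_none s _)
  | @seq p q s s' s'' a b _ _ ihp ihq =>
    intro emb ex hM
    exact (ihp (emb ∘ Sum.inl) (emb (Sum.inr (entry q))) fun l => hM (Sum.inl l)).trans
      (ihq (emb ∘ Sum.inr) ex fun l => hM (Sum.inr l))
  | @loop_zero k p s hs =>
    intro emb ex hM
    exact steps_test_zero (hM none) hs
  | @loop_succ k p s s' s'' a b hs _ _ ihp ihl =>
    intro emb ex hM
    exact ((steps_test_succ (hM none) hs).trans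
      (ihp (emb ∘ some) (emb none) fun l => hM (some l))).trans (ihl emb ex hM)
  | @ifz_zero k p q s s' a hs _ ih =>
    intro emb ex hM
    exact (steps_test_zero (hM none) hs).trans
      (ih (emb ∘ some ∘ Sum.inl) ex fun l => hM (some (Sum.inl l)))
  | @ifz_succ k p q s s' a hs _ ih =>
    intro emb ex hM
    exact (steps_test_succ (hM none) hs).trans
      (ih (emb ∘ some ∘ Sum.inr) ex fun l => hM (some (Sum.inr l)))

/-- The machine that runs a program and halts; its input is register `k₀`. -/
noncomputable def machine (p : Prog α n) (k₀ : Fin n) : FinTM2 where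
  K := Option (Fin n)
  k₀ := some k₀
  k₁ := none
  Γ := Alph α n
  Λ := Option (Label p)
  main := some (entry p)
  ΛFin := haveI := finite_label p; Fintype.ofFinite (Option (Label p))
  σ := Bool
  initialState := false
  Γk₀Fin := inferInstanceAs (Fintype Unit)
  m
    | none => .halt
    | some l => code p some none l

/-- The machine of a program, with its input and output alphabets. -/
noncomputable def computer (p : Prog α n) (k₀ : Fin n) : TM2ComputableAux Unit α where
  tm := machine p k₀
  inputAlphabet := Equiv.refl Unit
  outputAlphabet := Equiv.refl α

/-- A halting configuration must have every stack but the output empty, which is why the program has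
to end with all registers zero. The extra step is the halt instruction. -/
theorem Exec.outputs {p : Prog α n} {k₀ : Fin n} {i t : ℕ} {w : List α}
    (h : Exec p ⟨Function.update 0 k₀ i, []⟩ t ⟨0, w⟩) {T : ℕ} (hT : t + 1 ≤ T) :
    Nonempty (TM2OutputsInTime (computer p k₀).tm
      ((List.replicate i ()).map (computer p k₀).inputAlphabet.symm)
      (some (w.map (computer p k₀).outputAlphabet.symm)) T) := by
  have h1 := Exec.steps (M := (machine p k₀).m) h some none fun l => rfl
  refine ⟨⟨⟨t + 1, ?_⟩, hT⟩⟩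
  have h2 : Steps (machine p k₀).m 1 (config (none : Option (Label p)) (⟨0, w⟩ : St α n))
      ⟨none, false, tapes ⟨0, w⟩⟩ := by
    simp [Steps, flip, config, machine]
  have h3 := h1.trans h2
  have e1 : initList (computer p k₀).tm
      ((List.replicate i ()).map (computer p k₀).inputAlphabet.symm) =
      config (some (entry p) : Option (Label p)) ⟨Function.update 0 k₀ i, []⟩ := by
    unfold initList config
    congr 1
    funext k
    rcases k with _ | k
    · rfl
    · by_cases hk : k = k₀
      · subst hk
        simp [tapes, computer, machine]
        rfl
      · simp [tapes, computer, machine, hk]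
  have e2 : haltList (computer p k₀).tm (w.map (computer p k₀).outputAlphabet.symm) =
      ⟨none, false, tapes ⟨0, w⟩⟩ := by
    unfold haltList
    congr 1
    funext k
    rcases k with _ | k
    · simp [tapes, computer, machine]
      exact List.map_id w
    · rfl
  rw [e1, Option.map_some, e2]
  exact h3

end StackProgram

/-! ### Running-time bounds and counted loops. -/

namespace StackProgram

variable {α : Type} {n : ℕ}

/-- `p` leads from `s` to `s'` in at most `b` steps. -/
def Runs (p : Prog α n) (s : St α n) (b : ℕ) (s' : St α n) : Prop := ∃ t ≤ b, Exec p s t s'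

theorem Runs.mono {p : Prog α n} {s s' : St α n} {b b' : ℕ} (h : Runs p s b s') (hb : b ≤ b') :
    Runs p s b' s' := by
  obtain ⟨t, ht, h⟩ := h
  exact ⟨t, ht.trans hb, h⟩

theorem Runs.to {p : Prog α n} {s s₁ s' : St α n} {b b' : ℕ} (h : Runs p s b s₁)
    (hr : s₁.reg = s'.reg) (ho : s₁.out = s'.out) (hb : b ≤ b') : Runs p s b' s' := by
  have : s₁ = s' := by ext1 <;> assumption
  exact this ▸ h.mono hb

theorem Runs.seq {p q : Prog α n} {s s' s'' : St α n} {a b : ℕ} (h : Runs p s a s')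
    (h' : Runs q s' b s'') : Runs (.seq p q) s (a + b) s'' := by
  obtain ⟨t, ht, h⟩ := h
  obtain ⟨t', ht', h'⟩ := h'
  exact ⟨t + t', by omega, h.seq h'⟩

theorem runs_inc (k : Fin n) (r : Fin n → ℕ) (o : List α) :
    Runs (.inc k) ⟨r, o⟩ 1 ⟨Function.update r k (r k + 1), o⟩ := ⟨1, le_rfl, .inc k _⟩

theorem runs_dec (k : Fin n) (r : Fin n → ℕ) (o : List α) :
    Runs (.dec k) ⟨r, o⟩ 1 ⟨Function.update r k (r k - 1), o⟩ := ⟨1, le_rfl, .dec k _⟩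

theorem runs_emit (a : α) (r : Fin n → ℕ) (o : List α) :
    Runs (.emit a) ⟨r, o⟩ 1 ⟨r, a :: o⟩ := ⟨1, le_rfl, .emit a _⟩

theorem runs_skip (s : St α n) : Runs .skip s 1 s := ⟨1, le_rfl, .skip s⟩

theorem runs_ifz_zero {k : Fin n} {p q : Prog α n} {s s' : St α n} {b : ℕ} (h : s.reg k = 0)
    (hp : Runs p s b s') : Runs (.ifz k p q) s (b + 1) s' := by
  obtain ⟨t, ht, hp⟩ := hp
  exact ⟨1 + t, by omega, .ifz_zero h hp⟩

theorem runs_ifz_succ {k : Fin n} {p q : Prog α n} {s s' : St α n} {b : ℕ} (h : s.reg k ≠ 0)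
    (hq : Runs q s b s') : Runs (.ifz k p q) s (b + 1) s' := by
  obtain ⟨t, ht, hq⟩ := hq
  exact ⟨1 + t, by omega, .ifz_succ h hq⟩

/-- `S j` is the state with `j` rounds left, so a loop invariant is given as an explicit family of
states. -/
theorem runs_loop {k : Fin n} {p : Prog α n} (S : ℕ → St α n) (B N : ℕ)
    (hk : ∀ j ≤ N, (S j).reg k = j) (hp : ∀ j < N, Runs p (S (j + 1)) B (S j)) :
    Runs (.loop k p) (S N) (N * (B + 1) + 1) (S 0) := by
  induction N with
  | zero => exact ⟨1, by omega, .loop_zero (hk 0 le_rfl)⟩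
  | succ N ih =>
    obtain ⟨t, ht, h⟩ := ih (fun j hj => hk j (by omega)) fun j hj => hp j (by omega)
    obtain ⟨t', ht', h'⟩ := hp N (by omega)
    refine ⟨1 + t' + t, ?_, .loop_succ (by rw [hk _ le_rfl]; omega) h' h⟩
    have : (N + 1) * (B + 1) = N * (B + 1) + (B + 1) := by ring
    omega

/-- Set a register to zero. -/
def clear (k : Fin n) : Prog α n := .loop k (.dec k)

theorem runs_clear (k : Fin n) (r : Fin n → ℕ) (o : List α) {b : ℕ} (hb : r k ≤ b) :
    Runs (clear k) ⟨r, o⟩ (b * 2 + 1) ⟨Function.update r k 0, o⟩ := by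
  have := runs_loop (k := k) (p := .dec k) (fun j => (⟨Function.update r k j, o⟩ : St α n)) 1 (r k)
    (fun j _ => by simp) fun j _ => by simpa using runs_dec k (Function.update r k (j + 1)) o
  simp only [Function.update_eq_self] at this
  exact this.mono (by omega)

/-- Empty register `k` into register `a`. -/
def drain (k a : Fin n) : Prog α n := .loop k (.seq (.dec k) (.inc a))

theorem runs_drain {k a : Fin n} (hka : k ≠ a) (r : Fin n → ℕ) (o : List α) {b : ℕ}
    (hb : r k ≤ b) :
    Runs (drain k a) ⟨r, o⟩ (b * 3 + 1)
      ⟨Function.update (Function.update r k 0) a (r a + r k), o⟩ := by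
  have := runs_loop (k := k) (p := .seq (.dec k) (.inc a))
    (fun j => (⟨Function.update (Function.update r k j) a (r a + (r k - j)), o⟩ : St α n)) 2 (r k)
    (fun j _ => by simp [hka]) fun j hj => by
      refine ((runs_dec k _ o).seq (runs_inc a _ o)).to ?_ rfl le_rfl
      funext i
      grind [Function.update_apply]
  have h : Function.update (Function.update r k (r k)) a (r a + (r k - r k)) = r := by simp
  simp only [h, Nat.sub_zero] at this
  exact this.mono (by omega)

/-- Add register `k` to register `a`, using the empty register `t`. -/
def copy (k a t : Fin n) : Prog α n :=
  .seq (.loop k (.seq (.dec k) (.seq (.inc a) (.inc t)))) (drain t k)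

theorem runs_copy {k a t : Fin n} (hka : k ≠ a) (hkt : k ≠ t) (hat : a ≠ t) (r : Fin n → ℕ)
    (o : List α) (ht : r t = 0) {b : ℕ} (hb : r k ≤ b) :
    Runs (copy k a t) ⟨r, o⟩ (b * 7 + 2) ⟨Function.update r a (r a + r k), o⟩ := by
  have h1 := runs_loop (k := k) (p := .seq (.dec k) (.seq (.inc a) (.inc t)))
    (fun j => (⟨Function.update (Function.update (Function.update r k j) a (r a + (r k - j))) t
      (r k - j), o⟩ : St α n)) 3 (r k)
    (fun j _ => by simp [hka, hkt]) fun j hj => by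
      refine ((runs_dec k _ o).seq ((runs_inc a _ o).seq (runs_inc t _ o))).to ?_ rfl le_rfl
      funext i
      grind [Function.update_apply]
  have h : Function.update (Function.update (Function.update r k (r k)) a (r a + (r k - r k))) t
      (r k - r k) = r := by
    funext i
    grind [Function.update_apply]
  simp only [h] at h1
  have h2 := h1.seq (runs_drain (Ne.symm hkt) _ o (b := r k) (by simp))
  refine h2.to ?_ rfl (by omega)
  funext i
  grind [Function.update_apply]

/-- A counted loop: `body` is run with `k` descending from its initial value minus one to zero and
`kb` holding the complementary values; at the end both registers are restored. -/
def forLoop (k kb : Fin n) (body : Prog α n) : Prog α n :=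
  .seq (.loop k (.seq (.dec k) (.seq body (.inc kb)))) (drain kb k)

/-- Output is pushed on a stack, so the text printed last comes first: counting down produces the
blocks in ascending order. -/
theorem runs_forLoop {k kb : Fin n} (hne : k ≠ kb) {body : Prog α n} {N B : ℕ} {r : Fin n → ℕ}
    {o : List α} (hk : r k = N) (hkb : r kb = 0) (w : Fin N → List α)
    (hbody : ∀ (a : Fin N) (o : List α),
      Runs body ⟨Function.update (Function.update r k a) kb (N - 1 - a), o⟩ B
        ⟨Function.update (Function.update r k a) kb (N - 1 - a), w a ++ o⟩) :
    Runs (forLoop k kb body) ⟨r, o⟩ (N * (B + 6) + 2) ⟨r, (List.ofFn w).flatten ++ o⟩ := by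
  have h1 := runs_loop (k := k) (p := .seq (.dec k) (.seq body (.inc kb)))
    (fun j => (⟨Function.update (Function.update r k j) kb (N - j),
      ((List.ofFn w).drop j).flatten ++ o⟩ : St α n)) (1 + (B + 1)) N
    (fun j _ => by simp [hne]) fun j hj => by
      have e : ((List.ofFn w).drop j).flatten ++ o =
          w ⟨j, hj⟩ ++ (((List.ofFn w).drop (j + 1)).flatten ++ o) := by
        rw [List.drop_eq_getElem_cons (by simpa using hj)]
        simp
      have e1 : Function.update (Function.update (Function.update r k (j + 1)) kb (N - (j + 1))) k
          (Function.update (Function.update r k (j + 1)) kb (N - (j + 1)) k - 1) =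
          Function.update (Function.update r k j) kb (N - 1 - j) := by
        funext i
        grind [Function.update_apply]
      have hb := hbody ⟨j, hj⟩ (((List.ofFn w).drop (j + 1)).flatten ++ o)
      simp only [← e1] at hb
      refine ((runs_dec k _ _).seq (hb.seq (runs_inc kb _ _))).to ?_ e.symm le_rfl
      funext i
      grind [Function.update_apply]
  have h0 : Function.update (Function.update r k N) kb (N - N) = r := by
    funext i
    grind [Function.update_apply]
  have h2 : (List.ofFn w).drop N = [] := by simp
  simp only [h0, h2, List.flatten_nil, List.nil_append, List.drop_zero] at h1
  have h3 := h1.seq (runs_drain (Ne.symm hne) _ _ (b := N) (by simp))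
  refine h3.to ?_ rfl (by ring_nf; omega)
  funext i
  grind [Function.update_apply]

/-- Run the programs of a list one after the other. -/
def seqs : List (Prog α n) → Prog α n
  | [] => .skip
  | p :: l => .seq p (seqs l)

theorem runs_seqs_map {ι : Type} {f : ι → Prog α n} {w : ι → List α} {B : ℕ} {r : Fin n → ℕ}
    (h : ∀ x o, Runs (f x) ⟨r, o⟩ B ⟨r, w x ++ o⟩) (l : List ι) (o : List α) :
    Runs (seqs (l.map f)) ⟨r, o⟩ (l.length * B + 1) ⟨r, (l.reverse.map w).flatten ++ o⟩ := by
  induction l generalizing o with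
  | nil => exact (runs_skip _).mono (by simp)
  | cons x l ih =>
    have := (h x o).seq (ih (w x ++ o))
    simp only [List.map_cons, seqs, List.reverse_cons, List.map_append, List.flatten_append,
      List.map_nil, List.flatten_cons, List.flatten_nil, List.append_nil, List.append_assoc,
      List.length_cons]
    exact this.mono (by ring_nf; omega)

/-- Run the programs of a finite family in descending order. -/
def forFin {q : ℕ} (f : Fin q → Prog α n) : Prog α n := seqs ((List.finRange q).reverse.map f)

theorem runs_forFin {q : ℕ} {f : Fin q → Prog α n} {w : Fin q → List α} {B : ℕ} {r : Fin n → ℕ}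
    (h : ∀ x o, Runs (f x) ⟨r, o⟩ B ⟨r, w x ++ o⟩) (o : List α) :
    Runs (forFin f) ⟨r, o⟩ (q * B + 1) ⟨r, (List.ofFn w).flatten ++ o⟩ := by
  have := runs_seqs_map h (List.finRange q).reverse o
  simpa [forFin, List.ofFn_eq_map] using this

end StackProgram

/-! ### Modular arithmetic and comparison on registers. -/

namespace StackProgram

variable {α : Type} {n : ℕ}

/-- Increment the residue held in `u`, where `ub` holds its complement to the largest residue. -/
def incMod (u ub : Fin n) : Prog α n := .ifz ub (drain u ub) (.seq (.dec ub) (.inc u))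

theorem val_add_one_cases {i : ℕ} (a : ZMod (i + 1)) :
    (a.val = i ∧ (a + 1).val = 0) ∨ (a.val < i ∧ (a + 1).val = a.val + 1) := by
  have h : (a + 1).val = (a.val + 1) % (i + 1) := by
    rcases i with _ | i
    · have : ∀ z : ZMod 1, z.val = 0 := by decide
      rw [this, Nat.mod_one]
    · have : Fact (1 < i + 1 + 1) := ⟨by omega⟩
      rw [ZMod.val_add, ZMod.val_one]
  have := a.val_lt
  rcases Nat.lt_or_ge a.val i with hi | hi
  · right
    refine ⟨hi, ?_⟩
    rw [h, Nat.mod_eq_of_lt (by omega)]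
  · left
    have e : a.val = i := by omega
    refine ⟨e, ?_⟩
    rw [h, e, Nat.mod_self]

/-- Wrap-around is recognized by an empty complement register, so the modulus itself is never
consulted; draining `u` into `ub` then turns `(i, 0)` into `(0, i)`. -/
theorem runs_incMod {u ub : Fin n} (hne : u ≠ ub) {i : ℕ} (a : ZMod (i + 1)) {r : Fin n → ℕ}
    (o : List α) (hu : r u = a.val) (hub : r ub = i - a.val) :
    Runs (incMod u ub) ⟨r, o⟩ (3 * i + 3)
      ⟨Function.update (Function.update r u (a + 1).val) ub (i - (a + 1).val), o⟩ := by
  rcases val_add_one_cases a with ⟨h, h'⟩ | ⟨h, h'⟩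
  · refine (runs_ifz_zero (by simp [hub, h]) (runs_drain hne r o (b := i) (by omega))).to ?_ rfl
      (by omega)
    funext j
    grind [Function.update_apply]
  · refine (runs_ifz_succ (by simp [hub]; omega) ((runs_dec ub _ o).seq (runs_inc u _ o))).to ?_ rfl
      (by omega)
    funext j
    grind [Function.update_apply]

/-- Add register `w` to the residue held in `u`, using the empty register `t`. -/
def addMod (u ub w t : Fin n) : Prog α n :=
  .seq (.loop w (.seq (.dec w) (.seq (incMod u ub) (.inc t)))) (drain t w)

theorem runs_addMod {u ub w t : Fin n} (h1 : u ≠ ub) (h2 : u ≠ w) (h3 : u ≠ t) (h4 : ub ≠ w)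
    (h5 : ub ≠ t) (h6 : w ≠ t) {i : ℕ} (a c : ZMod (i + 1)) {r : Fin n → ℕ}
    (o : List α) (hu : r u = a.val) (hub : r ub = i - a.val) (hw : r w = c.val) (ht : r t = 0) :
    Runs (addMod u ub w t) ⟨r, o⟩ (3 * i * i + 9 * i + 3)
      ⟨Function.update (Function.update r u (a + c).val) ub (i - (a + c).val), o⟩ := by
  have hc := c.val_lt
  have key := runs_loop (k := w) (p := .seq (.dec w) (.seq (incMod u ub) (.inc t)))
    (fun j => (⟨Function.update (Function.update (Function.update (Function.update r w j) t
      (c.val - j)) u (a + ((c.val - j : ℕ) : ZMod (i + 1))).val) ub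
      (i - (a + ((c.val - j : ℕ) : ZMod (i + 1))).val), o⟩ : St α n)) (1 + (3 * i + 3 + 1)) c.val
    (fun j _ => by grind [Function.update_apply]) fun j hj => by
      have e : a + ((c.val - j : ℕ) : ZMod (i + 1)) =
          a + ((c.val - (j + 1) : ℕ) : ZMod (i + 1)) + 1 := by
        rw [show c.val - j = c.val - (j + 1) + 1 by omega]
        push_cast
        ring
      refine ((runs_dec w _ o).seq ((runs_incMod h1 (a + ((c.val - (j + 1) : ℕ) : ZMod (i + 1))) o
        ?_ ?_).seq (runs_inc t _ o))).to ?_ rfl le_rfl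
      · grind [Function.update_apply]
      · grind [Function.update_apply]
      · rw [e]
        funext j
        grind [Function.update_apply]
  have h0 : Function.update (Function.update (Function.update (Function.update r w c.val) t
      (c.val - c.val)) u (a + ((c.val - c.val : ℕ) : ZMod (i + 1))).val) ub
      (i - (a + ((c.val - c.val : ℕ) : ZMod (i + 1))).val) = r := by
    simp only [Nat.sub_self, Nat.cast_zero, add_zero]
    funext j
    grind [Function.update_apply]
  have hcc : ((c.val : ℕ) : ZMod (i + 1)) = c := by simp
  simp only [h0, Nat.sub_zero, hcc] at key
  refine (key.seq (runs_drain (Ne.symm h6) _ o (b := i) ?_)).to ?_ rfl ?_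
  · grind [Function.update_apply]
  · funext j
    grind [Function.update_apply]
  · have : c.val * (1 + (3 * i + 3 + 1) + 1) ≤ i * (1 + (3 * i + 3 + 1) + 1) :=
      Nat.mul_le_mul_right _ (by omega)
    have e : i * (1 + (3 * i + 3 + 1) + 1) = 3 * i * i + 6 * i := by ring
    omega

/-- Empty register `u`, adding its distance from register `k` to register `e`; register `t` is
empty before and after. -/
def compare (k u e t : Fin n) : Prog α n :=
  .seq (.loop k (.seq (.dec k) (.seq (.inc t) (.ifz u (.inc e) (.dec u)))))
    (.seq (drain t k) (drain u e))

/-- One of the two truncated differences is zero, so their sum is the distance. It is added to `e`,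
so that two points of the torus agree exactly when `e` is still zero after both coordinates are
compared. -/
theorem runs_compare {k u e t : Fin n} (h1 : k ≠ u) (h2 : k ≠ e) (h3 : k ≠ t) (h4 : u ≠ e)
    (h5 : u ≠ t) (h6 : e ≠ t) {r : Fin n → ℕ} (o : List α) {b : ℕ} (hk : r k ≤ b) (hu : r u ≤ b)
    (ht : r t = 0) :
    Runs (compare k u e t) ⟨r, o⟩ (11 * b + 3)
      ⟨Function.update (Function.update r u 0) e (r e + ((r u - r k) + (r k - r u))), o⟩ := by
  have key := runs_loop (k := k) (p := .seq (.dec k) (.seq (.inc t) (.ifz u (.inc e) (.dec u))))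
    (fun j => (⟨Function.update (Function.update (Function.update (Function.update r k j) t
      (r k - j)) u (r u - (r k - j))) e (r e + (r k - j - r u)), o⟩ : St α n)) (1 + (1 + (1 + 1)))
    (r k) (fun j _ => by grind [Function.update_apply]) fun j hj => by
      by_cases hz : r u - (r k - (j + 1)) = 0
      · refine ((runs_dec k _ o).seq ((runs_inc t _ o).seq (runs_ifz_zero ?_
          (runs_inc e _ o)))).to ?_ rfl le_rfl
        · grind [Function.update_apply]
        · funext j
          grind [Function.update_apply]
      · refine ((runs_dec k _ o).seq ((runs_inc t _ o).seq (runs_ifz_succ ?_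
          (runs_dec u _ o)))).to ?_ rfl le_rfl
        · grind [Function.update_apply]
        · funext j
          grind [Function.update_apply]
  have h0 : Function.update (Function.update (Function.update (Function.update r k (r k)) t
      (r k - r k)) u (r u - (r k - r k))) e (r e + (r k - r k - r u)) = r := by
    funext j
    grind [Function.update_apply]
  simp only [h0, Nat.sub_zero] at key
  refine (key.seq ((runs_drain (Ne.symm h3) _ o (b := b) ?_).seq
    (runs_drain h4 _ o (b := b) ?_))).to ?_ rfl (by omega)
  · grind [Function.update_apply]
  · grind [Function.update_apply]
  · funext j
    grind [Function.update_apply]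

end StackProgram

/-! ### The torus action and the program that prints the check matrices. -/

namespace BaseCode

/-- The six generating maps of the torus `(ℤ/N)²`: the two unit translations, the two elementary
shears, and the identity twice. -/
def act {N : ℕ} (g : Fin 6) (p : ZMod N × ZMod N) : ZMod N × ZMod N :=
  match g with
  | 0 => (p.1 + 1, p.2)
  | 1 => (p.1, p.2 + 1)
  | 2 => (p.1 + p.2, p.2)
  | 3 => (p.1, p.2 + p.1)
  | _ => p

/-- The action of a word, first letter first. -/
def actWord {N : ℕ} (w : List (Fin 6)) (p : ZMod N × ZMod N) : ZMod N × ZMod N :=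
  w.foldl (fun p g => act g p) p

end BaseCode

namespace StackProgram

open BaseCode

variable {α : Type}

/-- The program of a generating map; it acts on the residues in registers `8` and `10`. -/
def actProg (g : Fin 6) : Prog α 14 :=
  match g with
  | 0 => incMod 8 9
  | 1 => incMod 10 11
  | 2 => addMod 8 9 10 12
  | 3 => addMod 10 11 8 12
  | _ => .skip

/-- Store a point of the torus in the registers `8` to `11`. -/
def setPoint {i : ℕ} (r : Fin 14 → ℕ) (p : ZMod (i + 1) × ZMod (i + 1)) : Fin 14 → ℕ :=
  Function.update (Function.update (Function.update (Function.update r 8 p.1.val) 9 (i - p.1.val))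
    10 p.2.val) 11 (i - p.2.val)

theorem runs_actProg {i : ℕ} (g : Fin 6) (p : ZMod (i + 1) × ZMod (i + 1)) {r : Fin 14 → ℕ}
    (o : List α) (ht : r 12 = 0) :
    Runs (actProg g) ⟨setPoint r p, o⟩ (3 * i * i + 9 * i + 3) ⟨setPoint r (act g p), o⟩ := by
  fin_cases g
  · refine (runs_incMod (by decide) p.1 o ?_ ?_).to ?_ rfl (by nlinarith)
    · simp [setPoint]
    · simp [setPoint]
    · funext j
      simp only [setPoint, act]
      grind [Function.update_apply]
  · refine (runs_incMod (by decide) p.2 o ?_ ?_).to ?_ rfl (by nlinarith)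
    · simp [setPoint]
    · simp [setPoint]
    · funext j
      simp only [setPoint, act]
      grind [Function.update_apply]
  · refine (runs_addMod (by decide) (by decide) (by decide) (by decide) (by decide) (by decide)
      p.1 p.2 o ?_ ?_ ?_ ?_).to ?_ rfl le_rfl
    · simp [setPoint]
    · simp [setPoint]
    · simp [setPoint]
    · simp [setPoint, ht]
    · funext j
      simp only [setPoint, act]
      grind [Function.update_apply]
  · refine (runs_addMod (by decide) (by decide) (by decide) (by decide) (by decide) (by decide)
      p.2 p.1 o ?_ ?_ ?_ ?_).to ?_ rfl le_rfl
    · simp [setPoint]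
    · simp [setPoint]
    · simp [setPoint]
    · simp [setPoint, ht]
    · funext j
      simp only [setPoint, act]
      grind [Function.update_apply]
  · exact (runs_skip _).mono (by omega)
  · exact (runs_skip _).mono (by omega)

/-- The program of a word. -/
def wordProg (w : List (Fin 6)) : Prog α 14 := seqs (w.map actProg)

theorem runs_wordProg {i : ℕ} (w : List (Fin 6)) (p : ZMod (i + 1) × ZMod (i + 1)) {r : Fin 14 → ℕ}
    (o : List α) (ht : r 12 = 0) :
    Runs (wordProg w) ⟨setPoint r p, o⟩ (w.length * (3 * i * i + 9 * i + 3) + 1)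
      ⟨setPoint r (actWord w p), o⟩ := by
  induction w generalizing p with
  | nil => exact (runs_skip _).mono (by simp)
  | cons g w ih =>
    refine ((runs_actProg g p o ht).seq (ih (act g p))).mono ?_
    rw [List.length_cons, add_mul, one_mul]
    omega

/-- Print `h` if the point in registers `4` to `7` is mapped by the word `w` to the point in
registers `0` and `2`, and print `0` otherwise. -/
def entryProg (w : List (Fin 6)) (h : ZMod 2) : Prog (Option (ZMod 2)) 14 :=
  .seq (copy 4 8 12) (.seq (copy 5 9 12) (.seq (copy 6 10 12) (.seq (copy 7 11 12)
    (.seq (wordProg w) (.seq (compare 0 8 13 12) (.seq (compare 2 10 13 12) (.seq (clear 9)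
      (.seq (clear 11) (.seq (.ifz 13 (.emit (some h)) (.emit (some 0))) (clear 13))))))))))

/-- The word acts on a copy of `y` in registers `8` to `11`, and register `13` collects the distance
of the result from `x`. All scratch registers are cleared again, so only the output changes and the
program can be the body of nested loops. -/
theorem runs_entryProg {i : ℕ} (w : List (Fin 6)) (h : ZMod 2) (x y : ZMod (i + 1) × ZMod (i + 1))
    {r : Fin 14 → ℕ} (o : List (Option (ZMod 2))) (h0 : r 0 = x.1.val) (h2 : r 2 = x.2.val)
    (h4 : r 4 = y.1.val) (h5 : r 5 = i - y.1.val) (h6 : r 6 = y.2.val) (h7 : r 7 = i - y.2.val)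
    (h8 : r 8 = 0) (h9 : r 9 = 0) (h10 : r 10 = 0) (h11 : r 11 = 0) (h12 : r 12 = 0)
    (h13 : r 13 = 0) :
    Runs (entryProg w h) ⟨r, o⟩ (w.length * (3 * i * i + 9 * i + 3) + 60 * i + 30)
      ⟨r, some (if actWord w y = x then h else 0) :: o⟩ := by
  have hx1 := x.1.val_lt
  have hx2 := x.2.val_lt
  have hy1 := y.1.val_lt
  have hy2 := y.2.val_lt
  set z := actWord w y with hz
  have hz1 := z.1.val_lt
  have hz2 := z.2.val_lt
  have c1 := runs_copy (k := 4) (a := 8) (t := 12) (by decide) (by decide) (by decide) r o h12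
    (b := i) (by omega)
  have c2 := runs_copy (k := 5) (a := 9) (t := 12) (by decide) (by decide) (by decide)
    (Function.update r 8 (r 8 + r 4)) o (by simp [h12]) (b := i) (by simp [h5])
  have c3 := runs_copy (k := 6) (a := 10) (t := 12) (by decide) (by decide) (by decide)
    (Function.update (Function.update r 8 (r 8 + r 4)) 9 (r 9 + r 5)) o (by simp [h12]) (b := i)
    (by simp [h6]; omega)
  have c4 := runs_copy (k := 7) (a := 11) (t := 12) (by decide) (by decide) (by decide)
    (Function.update (Function.update (Function.update r 8 (r 8 + r 4)) 9 (r 9 + r 5)) 10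
      (r 10 + r 6)) o (by simp [h12]) (b := i) (by simp [h7])
  have c4' := c4.to (s' := ⟨setPoint r y, o⟩) (b' := i * 7 + 2)
    (by simp [setPoint, h4, h5, h6, h7, h8, h9, h10, h11]) rfl le_rfl
  have cw := runs_wordProg w y o h12
  rw [← hz] at cw
  set d₁ := z.1.val - x.1.val + (x.1.val - z.1.val) with hd₁
  set d₂ := z.2.val - x.2.val + (x.2.val - z.2.val) with hd₂
  have d1 := (runs_compare (k := 0) (u := 8) (e := 13) (t := 12) (by decide) (by decide)
    (by decide) (by decide) (by decide) (by decide) (r := setPoint r z) o (b := i)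
    (by simp [setPoint, h0]; omega) (by simp [setPoint]; omega) (by simp [setPoint, h12])).to
    (s' := ⟨Function.update (Function.update (setPoint r z) 8 0) 13 d₁, o⟩)
    (by simp [setPoint, h0, h13, hd₁]) rfl le_rfl
  have d2 := (runs_compare (k := 2) (u := 10) (e := 13) (t := 12) (by decide) (by decide)
    (by decide) (by decide) (by decide) (by decide)
    (r := Function.update (Function.update (setPoint r z) 8 0) 13 d₁) o (b := i)
    (by simp [setPoint, h2]; omega) (by simp [setPoint]; omega) (by simp [setPoint, h12])).to
    (s' := ⟨Function.update (Function.update (Function.update (setPoint r z) 8 0) 10 0) 13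
      (d₁ + d₂), o⟩)
    (by
      funext j
      simp only [setPoint]
      grind [Function.update_apply]) rfl le_rfl
  have e1 := runs_clear 9 (Function.update (Function.update (Function.update (setPoint r z) 8 0)
    10 0) 13 (d₁ + d₂)) o (b := i) (by simp [setPoint])
  have e2 := (runs_clear 11 (Function.update (Function.update (Function.update (Function.update
    (setPoint r z) 8 0) 10 0) 13 (d₁ + d₂)) 9 0) o (b := i) (by simp [setPoint])).to
    (s' := ⟨Function.update r 13 (d₁ + d₂), o⟩)
    (by
      funext j
      fin_cases j <;> simp [setPoint, h8, h9, h10, h11]) rfl le_rfl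
  have f1 : Runs (.ifz 13 (.emit (some h)) (.emit (some 0)))
      ⟨Function.update r 13 (d₁ + d₂), o⟩ (1 + 1)
      ⟨Function.update r 13 (d₁ + d₂), some (if z = x then h else 0) :: o⟩ := by
    by_cases hzx : z = x
    · rw [if_pos hzx]
      refine runs_ifz_zero ?_ (runs_emit _ _ _)
      simp [hd₁, hd₂, hzx]
    · rw [if_neg hzx]
      refine runs_ifz_succ ?_ (runs_emit _ _ _)
      intro hd
      simp only [Function.update_self] at hd
      refine hzx (Prod.ext (ZMod.val_injective _ ?_) (ZMod.val_injective _ ?_)) <;> omega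
  have f2 := (runs_clear 13 (Function.update r 13 (d₁ + d₂))
    (some (if z = x then h else 0) :: o) (b := 2 * i) (by simp; omega)).to
    (s' := ⟨r, some (if z = x then h else 0) :: o⟩)
    (by
      funext j
      grind [Function.update_apply]) rfl le_rfl
  refine ((c1.to (by simp) rfl le_rfl).seq ((c2.to (by simp) rfl le_rfl).seq
    ((c3.to (by simp) rfl le_rfl).seq (c4'.seq (cw.seq (d1.seq (d2.seq (e1.seq (e2.seq
      (f1.seq f2)))))))))).mono ?_
  omega

/-- Enumeration of triples in lexicographic order. -/
def tripleEquiv (N q : ℕ) : Fin N × Fin N × Fin q ≃ Fin (N * (N * q)) :=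
  ((Equiv.refl _).prodCongr finProdFinEquiv).trans finProdFinEquiv

theorem ofFn_prod {β : Type} {m k : ℕ} (f : Fin (m * k) → β) :
    List.ofFn f =
      (List.ofFn fun a : Fin m => List.ofFn fun b : Fin k => f (finProdFinEquiv (a, b))).flatten := by
  rw [List.ofFn_mul]
  congr 2
  funext a
  congr 1
  funext b
  congr 1
  ext
  simp [finProdFinEquiv]
  ring

theorem ofFn_triple {β : Type} {N q : ℕ} (f : Fin N × Fin N × Fin q → β) :
    List.ofFn (fun z => f ((tripleEquiv N q).symm z)) =
      (List.ofFn fun a : Fin N => (List.ofFn fun b : Fin N =>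
        List.ofFn fun l : Fin q => f (a, b, l)).flatten).flatten := by
  rw [ofFn_prod]
  congr 2
  funext a
  rw [ofFn_prod]
  congr 2
  funext b
  congr 1
  funext l
  congr 1
  rw [Equiv.symm_apply_eq]
  rfl

theorem flatten_ofFn_triple {β : Type} {N q : ℕ} (f : Fin N × Fin N × Fin q → List β) :
    (List.ofFn (fun z => f ((tripleEquiv N q).symm z))).flatten =
      (List.ofFn fun a : Fin N => (List.ofFn fun b : Fin N =>
        (List.ofFn fun l : Fin q => f (a, b, l)).flatten).flatten).flatten := by
  rw [ofFn_triple f]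
  simp only [List.flatten_flatten, List.map_ofFn, Function.comp_def]

/-- The point of the torus with given coordinates. -/
def point {N : ℕ} (a b : Fin N) : ZMod N × ZMod N := ((a : ℕ), (b : ℕ))

theorem val_natCast_fin {i : ℕ} (a : Fin (i + 1)) : ((a : ℕ) : ZMod (i + 1)).val = a :=
  ZMod.val_cast_of_lt a.2

theorem val_point_fst {i : ℕ} (a b : Fin (i + 1)) : (point a b).1.val = a := val_natCast_fin a

theorem val_point_snd {i : ℕ} (a b : Fin (i + 1)) : (point a b).2.val = b := val_natCast_fin b

theorem flatten_ofFn_singleton {β : Type} {m : ℕ} (f : Fin m → β) :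
    (List.ofFn fun s => [f s]).flatten = List.ofFn f := by
  rw [List.ofFn_eq_map, List.ofFn_eq_map]
  induction List.finRange m with
  | nil => rfl
  | cons a l ih => simp [ih]

section Print

variable {q D : ℕ} (wd : Fin q → Fin D → List (Fin 6)) (h : Fin q → Fin D → ZMod 2)

/-- The matrix with rows `(x, l)` and columns `(y, s)`, where `x`, `y` are points of the torus,
whose entry is `h l s` if the word `wd l s` maps `y` to `x` and `0` otherwise. -/
def checkMatrix (N : ℕ) : Matrix (Fin (N * (N * q))) (Fin (N * (N * D))) (ZMod 2) := fun u v =>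
  let x := (tripleEquiv N q).symm u
  let y := (tripleEquiv N D).symm v
  if actWord (wd x.2.2 y.2.2) (point y.1 y.2.1) = point x.1 x.2.1 then h x.2.2 y.2.2 else 0

/-- Print one row of `checkMatrix`. -/
def rowProg (l : Fin q) : Prog (Option (ZMod 2)) 14 :=
  .seq (.emit none) (forLoop 4 5 (forLoop 6 7 (forFin fun s => entryProg (wd l s) (h l s))))

/-- The number of steps needed to print one entry. -/
def entryTime (L i : ℕ) : ℕ := L * (3 * i * i + 9 * i + 3) + 60 * i + 31

/-- The number of steps needed to print one row. -/
def rowTime (D L i : ℕ) : ℕ :=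
  (i + 1) * ((i + 1) * (D * entryTime L i + 7) + 8) + 3

/-- The separator is emitted first because it must end up behind the row. In each round the two loop
registers of a coordinate hold the residue and its complement to `i`, the form that `entryProg`
expects of `y`. -/
theorem runs_rowProg {i L : ℕ} (hL : ∀ l s, (wd l s).length ≤ L) (l : Fin q) (a b : Fin (i + 1))
    {r : Fin 14 → ℕ} (o : List (Option (ZMod 2))) (h0 : r 0 = a) (h2 : r 2 = b)
    (h4 : r 4 = i + 1) (h5 : r 5 = 0) (h6 : r 6 = i + 1) (h7 : r 7 = 0)
    (h8 : r 8 = 0) (h9 : r 9 = 0) (h10 : r 10 = 0) (h11 : r 11 = 0) (h12 : r 12 = 0)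
    (h13 : r 13 = 0) :
    Runs (rowProg wd h l) ⟨r, o⟩ (rowTime D L i)
      ⟨r, (List.ofFn fun v => some (checkMatrix wd h (i + 1) (tripleEquiv _ _ (a, b, l)) v)) ++ [none]
        ++ o⟩ := by
  have key := runs_forLoop (k := 4) (kb := 5) (by decide) (N := i + 1)
    (body := forLoop 6 7 (forFin fun s => entryProg (wd l s) (h l s)))
    (o := none :: o) h4 h5 (fun c => (List.ofFn fun d : Fin (i + 1) => (List.ofFn fun s : Fin D =>
      [some (if actWord (wd l s) (point c d) = point a b then h l s else 0)]).flatten).flatten)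
    (B := (i + 1) * (D * entryTime L i + 1 + 6) + 2) fun c o =>
      runs_forLoop (k := 6) (kb := 7) (by decide) (by simp [h6]) (by simp [h7]) _ fun d o => by
        refine runs_forFin (fun s o => ?_) o
        refine (runs_entryProg (wd l s) (h l s) (point a b) (point c d) o ?_ ?_ ?_ ?_ ?_ ?_ ?_ ?_
          ?_ ?_ ?_ ?_).mono ?_
        any_goals simp [val_point_fst, val_point_snd, h0, h2, h8, h9, h10, h11, h12, h13]
        have := Nat.mul_le_mul_right (3 * i * i + 9 * i + 3) (hL l s)
        unfold entryTime
        omega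
  refine ((runs_emit none r o).seq key).to rfl ?_ ?_
  · have := ofFn_triple (N := i + 1) (fun y : Fin (i + 1) × Fin (i + 1) × Fin D =>
      some (if actWord (wd l y.2.2) (point y.1 y.2.1) = point a b then h l y.2.2 else 0))
    simp only [checkMatrix, Equiv.symm_apply_apply]
    rw [this]
    simp only [flatten_ofFn_singleton, List.append_assoc, List.singleton_append]
  · unfold rowTime
    ring_nf
    omega

/-- Print `checkMatrix (i + 1)`, given `i` in register `0`. -/
def matrixProg : Prog (Option (ZMod 2)) 14 :=
  .seq (.inc 0) (.seq (copy 0 2 12) (.seq (copy 0 4 12) (.seq (copy 0 6 12)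
    (.seq (forLoop 0 1 (forLoop 2 3 (forFin fun l => rowProg wd h l)))
      (.seq (clear 0) (.seq (clear 2) (.seq (clear 4) (clear 6))))))))

theorem runs_matrixProg {i L : ℕ} (hL : ∀ l s, (wd l s).length ≤ L) :
    Runs (matrixProg wd h) ⟨Function.update 0 0 i, []⟩
      ((i + 1) * ((i + 1) * (q * rowTime D L i + 7) + 8) + 29 * (i + 1) + 13)
      ⟨0, matrixWord (checkMatrix wd h (i + 1))⟩ := by
  set r : Fin 14 → ℕ := Function.update (Function.update (Function.update (Function.update 0 0
    (i + 1)) 2 (i + 1)) 4 (i + 1)) 6 (i + 1) with hr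
  have c0 := (runs_inc 0 (Function.update 0 0 i : Fin 14 → ℕ) ([] : List (Option (ZMod 2)))).to
    (s' := ⟨Function.update 0 0 (i + 1), []⟩) (by simp) rfl le_rfl
  have c1 := (runs_copy (k := 0) (a := 2) (t := 12) (by decide) (by decide) (by decide)
    (Function.update 0 0 (i + 1) : Fin 14 → ℕ) ([] : List (Option (ZMod 2))) (by simp)
    (b := i + 1) (by simp)).to
    (s' := ⟨Function.update (Function.update 0 0 (i + 1)) 2 (i + 1), []⟩) (by simp) rfl le_rfl
  have c2 := (runs_copy (k := 0) (a := 4) (t := 12) (by decide) (by decide) (by decide)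
    (Function.update (Function.update 0 0 (i + 1)) 2 (i + 1) : Fin 14 → ℕ)
    ([] : List (Option (ZMod 2))) (by simp) (b := i + 1) (by simp)).to
    (s' := ⟨Function.update (Function.update (Function.update 0 0 (i + 1)) 2 (i + 1)) 4 (i + 1), []⟩)
    (by simp) rfl le_rfl
  have c3 := (runs_copy (k := 0) (a := 6) (t := 12) (by decide) (by decide) (by decide)
    (Function.update (Function.update (Function.update 0 0 (i + 1)) 2 (i + 1)) 4 (i + 1) :
      Fin 14 → ℕ) ([] : List (Option (ZMod 2))) (by simp) (b := i + 1) (by simp)).to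
    (s' := ⟨r, []⟩) (by simp [hr]) rfl le_rfl
  have key := runs_forLoop (k := 0) (kb := 1) (by decide) (N := i + 1) (r := r)
    (body := forLoop 2 3 (forFin fun l => rowProg wd h l))
    (o := ([] : List (Option (ZMod 2)))) (by simp [hr]) (by simp [hr])
    (fun a => (List.ofFn fun b : Fin (i + 1) => (List.ofFn fun l : Fin q =>
      (List.ofFn fun v => some (checkMatrix wd h (i + 1) (tripleEquiv _ _ (a, b, l)) v)) ++
        [none]).flatten).flatten)
    (B := (i + 1) * (q * rowTime D L i + 1 + 6) + 2) fun a o =>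
      runs_forLoop (k := 2) (kb := 3) (by decide) (by simp [hr]) (by simp [hr]) _ fun b o =>
        runs_forFin (fun l o => runs_rowProg wd h hL l a b o (by simp [hr]) (by simp [hr])
          (by simp [hr]) (by simp [hr]) (by simp [hr]) (by simp [hr]) (by simp [hr]) (by simp [hr])
          (by simp [hr]) (by simp [hr]) (by simp [hr]) (by simp [hr])) o
  have hw : (List.ofFn fun a => (List.ofFn fun b : Fin (i + 1) => (List.ofFn fun l : Fin q =>
      (List.ofFn fun v => some (checkMatrix wd h (i + 1) (tripleEquiv _ _ (a, b, l)) v)) ++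
        [none]).flatten).flatten).flatten ++ [] = matrixWord (checkMatrix wd h (i + 1)) := by
    have := flatten_ofFn_triple (N := i + 1) (fun x : Fin (i + 1) × Fin (i + 1) × Fin q =>
      (List.ofFn fun v => some (checkMatrix wd h (i + 1) (tripleEquiv _ _ x) v)) ++ [none])
    simp only [Equiv.apply_symm_apply] at this
    rw [matrixWord, this, List.append_nil]
  rw [hw] at key
  set W := matrixWord (checkMatrix wd h (i + 1))
  have e0 := runs_clear 0 r W (b := i + 1) (by simp [hr])
  have e1 := runs_clear 2 (Function.update r 0 0) W (b := i + 1) (by simp [hr])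
  have e2 := runs_clear 4 (Function.update (Function.update r 0 0) 2 0) W (b := i + 1)
    (by simp [hr])
  have e3 := (runs_clear 6 (Function.update (Function.update (Function.update r 0 0) 2 0) 4 0) W
    (b := i + 1) (by simp [hr])).to (s' := ⟨0, W⟩)
    (by
      funext j
      fin_cases j <;> simp [hr]) rfl le_rfl
  refine (c0.seq (c1.seq (c2.seq (c3.seq (key.seq (e0.seq (e1.seq (e2.seq e3)))))))).mono ?_
  ring_nf
  omega

end Print

/-! ### Polynomial running time. -/

/-- The function is bounded by a polynomial. -/
def PolyBounded (f : ℕ → ℕ) : Prop := ∃ P : Polynomial ℕ, ∀ i, f i ≤ P.eval i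

theorem polyBounded_const (c : ℕ) : PolyBounded fun _ => c := ⟨Polynomial.C c, fun i => by simp⟩

theorem polyBounded_id : PolyBounded fun i => i := ⟨Polynomial.X, fun i => by simp⟩

theorem PolyBounded.add {f g : ℕ → ℕ} (hf : PolyBounded f) (hg : PolyBounded g) :
    PolyBounded fun i => f i + g i := by
  obtain ⟨P, hP⟩ := hf
  obtain ⟨Q, hQ⟩ := hg
  exact ⟨P + Q, fun i => by simpa using Nat.add_le_add (hP i) (hQ i)⟩

theorem PolyBounded.mul {f g : ℕ → ℕ} (hf : PolyBounded f) (hg : PolyBounded g) :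
    PolyBounded fun i => f i * g i := by
  obtain ⟨P, hP⟩ := hf
  obtain ⟨Q, hQ⟩ := hg
  exact ⟨P * Q, fun i => by simpa using Nat.mul_le_mul (hP i) (hQ i)⟩

theorem eval_mono (P : Polynomial ℕ) {a b : ℕ} (h : a ≤ b) : P.eval a ≤ P.eval b := by
  rw [Polynomial.eval_eq_sum, Polynomial.eval_eq_sum]
  exact Finset.sum_le_sum fun k _ => Nat.mul_le_mul_left _ (Nat.pow_le_pow_left h k)

/-- The matrices `checkMatrix` are printed by one machine in polynomial time. -/
theorem exists_computer_checkMatrix {q D : ℕ} (hD : 0 < D) (wd : Fin q → Fin D → List (Fin 6))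
    (h : Fin q → Fin D → ZMod 2) :
    ∃ (M : Turing.TM2ComputableAux Unit (Option (ZMod 2))) (T : Polynomial ℕ),
      ∀ i, Nonempty (Turing.TM2OutputsInTime M.tm
        ((List.replicate i ()).map M.inputAlphabet.symm)
        (some ((matrixWord (checkMatrix wd h (i + 1))).map M.outputAlphabet.symm))
        (T.eval ((i + 1) * ((i + 1) * D)))) := by
  obtain ⟨L, hL⟩ : ∃ L, ∀ l s, (wd l s).length ≤ L :=
    ⟨∑ l, ∑ s, (wd l s).length, fun l s =>
      (Finset.single_le_sum (f := fun s => (wd l s).length) (fun _ _ => Nat.zero_le _)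
        (Finset.mem_univ s)).trans
      (Finset.single_le_sum (f := fun l => ∑ s, (wd l s).length) (fun _ _ => Nat.zero_le _)
        (Finset.mem_univ l))⟩
  have hpoly : PolyBounded fun i =>
      (i + 1) * ((i + 1) * (q * rowTime D L i + 7) + 8) + 29 * (i + 1) + 13 + 1 := by
    unfold rowTime entryTime
    repeat first
      | exact polyBounded_const _
      | exact polyBounded_id
      | apply PolyBounded.add
      | apply PolyBounded.mul
  obtain ⟨T, hT⟩ := hpoly
  refine ⟨computer (matrixProg wd h) 0, T, fun i => ?_⟩
  obtain ⟨t, ht, hrun⟩ := runs_matrixProg wd h (i := i) hL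
  -- A bound polynomial in `i` is enough: `i` is at most the length of the code, and polynomials
  -- over `ℕ` are monotone.
  refine hrun.outputs ((Nat.succ_le_succ ht).trans ((hT i).trans (eval_mono T ?_)))
  calc i ≤ (i + 1) * 1 := by omega
    _ ≤ (i + 1) * ((i + 1) * D) := Nat.mul_le_mul_left _ (Nat.mul_pos (by omega) hD)

end StackProgram

/-! ### Smooth codes and agreement testability. -/

namespace BaseCode

open Finset

/-- A check matrix is smooth if deleting all checks that touch a small set `A` of coordinates
only lets words of small weight grow inside a set `A'` of comparable size. -/
def IsSmooth {m r : ℕ} (H : Matrix (Fin m) (Fin r) (ZMod 2)) (α K κ : ℝ) : Prop :=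
  ∀ A : Finset (Fin r), (#A : ℝ) ≤ α * r → ∃ A' : Finset (Fin r), A ⊆ A' ∧ (#A' : ℝ) ≤ K * #A ∧
    ∀ x : Fin r → ZMod 2, (hammingNorm x : ℝ) ≤ κ * r →
      (∀ j, (∀ a ∈ A, H j a = 0) → ∑ v, H j v * x v = 0) → ∀ v ∉ A', x v = 0

section

variable {m r : ℕ} {H : Matrix (Fin m) (Fin r) (ZMod 2)} {C : LinearCode r} {α K κ : ℝ}

theorem mem_iff_sum (hC : ∀ x, x ∈ C ↔ H.mulVec x = 0) (x : Fin r → ZMod 2) :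
    x ∈ C ↔ ∀ j, ∑ v, H j v * x v = 0 := by
  rw [hC, funext_iff]
  rfl

/-- The case `A = ∅` of smoothness: no check is dropped, and `A'` is empty because its size is at
most `K * 0`. -/
theorem IsSmooth.eq_zero_of_weight_le (hH : IsSmooth H α K κ) (hα : 0 ≤ α)
    (hC : ∀ x, x ∈ C ↔ H.mulVec x = 0) {x : Fin r → ZMod 2} (hx : x ∈ C)
    (hw : (hammingNorm x : ℝ) ≤ κ * r) : x = 0 := by
  obtain ⟨A', -, hA', h⟩ := hH ∅ (by simp; positivity)
  have hA0 : A' = ∅ := by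
    rw [← card_eq_zero]
    simpa using hA'
  funext v
  exact h x hw (fun j _ => (mem_iff_sum hC x).1 hx j) v (by simp [hA0])

theorem hammingNorm_le_card {x : Fin r → ZMod 2} {A : Finset (Fin r)} (h : ∀ v ∉ A, x v = 0) :
    hammingNorm x ≤ #A := by
  refine card_le_card fun v hv => ?_
  by_contra hvA
  simp [h v hvA] at hv

/-- A word is determined by its values off `A` if no nonzero codeword lives on `A`. -/
theorem exists_projection {A : Finset (Fin r)} (hA : ∀ c ∈ C, (∀ v ∉ A, c v = 0) → c = 0) :
    ∃ Q : (Fin r → ZMod 2) →ₗ[ZMod 2] (Fin r → ZMod 2), (∀ x, Q x ∈ C) ∧ (∀ c ∈ C, Q c = c) ∧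
      ∀ x y, (∀ v ∉ A, x v = y v) → Q x = Q y := by
  classical
  let ρ : (Fin r → ZMod 2) →ₗ[ZMod 2] (Fin r → ZMod 2) :=
    { toFun := fun x v => if v ∈ A then 0 else x v
      map_add' := fun x y => by
        funext v
        by_cases hv : v ∈ A <;> simp [hv]
      map_smul' := fun a x => by
        funext v
        by_cases hv : v ∈ A <;> simp [hv] }
  have hker : LinearMap.ker (ρ ∘ₗ C.subtype) = ⊥ := by
    rw [LinearMap.ker_eq_bot']
    intro c hc
    refine Subtype.ext (hA c c.2 fun v hv => ?_)
    have := congrFun hc v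
    simpa [ρ, hv] using this
  -- Restriction off `A` is injective on `C`; a left inverse is an erasure decoder that is linear on
  -- all words, not only on codewords.
  obtain ⟨φ, hφ⟩ := LinearMap.exists_leftInverse_of_injective _ hker
  refine ⟨C.subtype ∘ₗ φ ∘ₗ ρ, fun x => (φ (ρ x)).2, fun c hc => ?_, fun x y hxy => ?_⟩
  · have := LinearMap.congr_fun hφ ⟨c, hc⟩
    simpa using congrArg Subtype.val this
  · have : ρ x = ρ y := by
      funext v
      by_cases hv : v ∈ A
      · simp [ρ, hv]
      · simp [ρ, hv, hxy v hv]
    simp [this]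

/-- Matrices with rows, respectively columns, in the code that agree off few rows and columns
come from one tensor codeword. -/
theorem exists_tensorCode_of_agree {A B : Finset (Fin r)}
    (hA : ∀ c ∈ C, (∀ v ∉ A, c v = 0) → c = 0) (hB : ∀ c ∈ C, (∀ v ∉ B, c v = 0) → c = 0)
    {f g : Matrix (Fin r) (Fin r) (ZMod 2)} (hf : f ∈ rowCode C) (hg : g ∈ colCode C)
    (hfg : ∀ v ∉ A, ∀ u ∉ B, f v u = g v u) :
    ∃ w ∈ tensorCode C, (∀ v ∉ A, f.row v = w.row v) ∧ ∀ u ∉ B, g.col u = w.col u := by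
  obtain ⟨Q, hQC, hQid, hQ⟩ := exists_projection hA
  -- Every column of `f` is decoded. Columns of `w` then lie in `C`, and by linearity of the decoder
  -- rows of `w` are combinations of rows of `f`, so they lie in `C` too.
  let w : Matrix (Fin r) (Fin r) (ZMod 2) := fun v u => Q (f.col u) v
  have hwcol : ∀ u, w.col u = Q (f.col u) := fun u => rfl
  have hwrow : ∀ v, w.row v ∈ C := fun v => by
    have : w.row v = ∑ i, Q (Pi.single i 1) v • f.row i := by
      funext u
      have e : f.col u = ∑ i, f i u • (Pi.single i 1 : Fin r → ZMod 2) := by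
        funext k
        simp [Finset.sum_apply, Pi.single_apply, Matrix.col]
      change Q (f.col u) v = _
      rw [e, map_sum, Finset.sum_apply, Finset.sum_apply]
      refine sum_congr rfl fun i _ => ?_
      simp [Matrix.row, mul_comm]
    rw [this]
    exact Submodule.sum_mem _ fun i _ => Submodule.smul_mem _ _ (hf i)
  have hcol : ∀ u ∉ B, g.col u = w.col u := fun u hu => by
    rw [hwcol, ← hQid _ (hg u)]
    exact hQ _ _ fun v hv => (hfg v hv u hu).symm
  refine ⟨w, ⟨hwrow, fun u => hQC _⟩, fun v hv => ?_, hcol⟩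
  -- For `v ∉ A` the rows of `f` and `w` agree off `B`, since both equal `g` there; their difference
  -- is a codeword on `B`, hence zero.
  have := hB (f.row v - w.row v) (C.sub_mem (hf v) (hwrow v)) fun u hu => by
    have := congrFun (hcol u hu) v
    simp only [Matrix.col_apply] at this
    simp [hfg v hv u hu, this]
  exact sub_eq_zero.1 this

/-- The words of a smooth code's sum code with few nonzero entries in each row and column off
`A` and `B` vanish off slightly larger sets. -/
theorem IsSmooth.exists_support (hH : IsSmooth H α K κ) {d : ℕ}
    (hd : ∀ j, #{v | H j v ≠ 0} ≤ d) (hd0 : 0 < d) (hκ : 0 ≤ κ)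
    {E : Matrix (Fin r) (Fin r) (ZMod 2)} (hE : ∀ j k, ∑ v, H j v * ∑ u, E v u * H k u = 0)
    {A B : Finset (Fin r)} (hA : (#A : ℝ) ≤ α * r) (hB : (#B : ℝ) ≤ α * r)
    (hrow : ∀ v ∉ A, (#{u | E v u ≠ 0} : ℝ) ≤ κ / d * r)
    (hcol : ∀ u ∉ B, (#{v | E v u ≠ 0} : ℝ) ≤ κ / d * r) :
    ∃ A' B' : Finset (Fin r), (#A' : ℝ) ≤ K * #A ∧ (#B' : ℝ) ≤ K * #B ∧
      ∀ v ∉ A', ∀ u ∉ B', E v u = 0 := by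
  obtain ⟨A', hAA', hA', hA''⟩ := hH A hA
  obtain ⟨B', hBB', hB', hB''⟩ := hH B hB
  refine ⟨A', B', hA', hB', ?_⟩
  have hd' : (0 : ℝ) < d := by exact_mod_cast hd0
  let E' : Matrix (Fin r) (Fin r) (ZMod 2) := fun v u => if v ∈ A ∨ u ∈ B then 0 else E v u
  -- `E'` is `E` with heavy rows and columns erased. Its product with a check avoiding `B` adds up
  -- at most `d` light columns, so it has weight at most `d * (κ / d * r) = κ * r`. Checks avoiding
  -- `A` do not notice the erased rows, so smoothness confines the product to `A'`.
  have hF : ∀ k, (∀ b ∈ B, H k b = 0) → ∀ v ∉ A', ∑ u, H k u * E' v u = 0 := by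
    intro k hk
    refine hA'' (fun v => ∑ u, H k u * E' v u) ?_ ?_
    · have hsub : ({v | ∑ u, H k u * E' v u ≠ 0} : Finset (Fin r)) ⊆
          (({u | H k u ≠ 0} : Finset (Fin r)).filter (· ∉ B)).biUnion
            fun u => ({v | E v u ≠ 0} : Finset (Fin r)) := by
        intro v hv
        obtain ⟨u, -, hu⟩ := exists_ne_zero_of_sum_ne_zero (mem_filter.1 hv).2
        have h1 : H k u ≠ 0 := left_ne_zero_of_mul hu
        have h2 : E' v u ≠ 0 := right_ne_zero_of_mul hu
        simp only [E', ne_eq, ite_eq_left_iff, not_forall] at h2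
        obtain ⟨h3, h4⟩ := h2
        push Not at h3
        simp only [mem_biUnion, mem_filter, mem_univ, true_and]
        exact ⟨u, ⟨h1, h3.2⟩, h4⟩
      calc (hammingNorm (fun v => ∑ u, H k u * E' v u) : ℝ)
          ≤ ∑ u ∈ ({u | H k u ≠ 0} : Finset (Fin r)).filter (· ∉ B),
              (#{v | E v u ≠ 0} : ℝ) := by
            exact_mod_cast (card_le_card hsub).trans card_biUnion_le
        _ ≤ ∑ u ∈ ({u | H k u ≠ 0} : Finset (Fin r)).filter (· ∉ B), κ / d * r :=
            sum_le_sum fun u hu => hcol u (mem_filter.1 hu).2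
        _ ≤ d * (κ / d * r) := by
            rw [sum_const, nsmul_eq_mul]
            refine mul_le_mul_of_nonneg_right ?_ (by positivity)
            exact_mod_cast (card_filter_le _ _).trans (hd k)
        _ = κ * r := by field_simp
    · intro j hj
      rw [← hE j k]
      refine sum_congr rfl fun v _ => ?_
      by_cases hv : v ∈ A
      · rw [hj v hv, zero_mul, zero_mul]
      · congr 1
        refine sum_congr rfl fun u _ => ?_
        by_cases hu : u ∈ B
        · rw [hk u hu, zero_mul, mul_zero]
        · simp [E', hv, hu, mul_comm]
  -- By `hF`, row `v` of `E'` satisfies all checks avoiding `B`, and it is light because `v ∉ A`: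
  -- smoothness in the other direction.
  intro v hv u hu
  have hvA : v ∉ A := fun h => hv (hAA' h)
  have huB : u ∉ B := fun h => hu (hBB' h)
  have := hB'' (E' v) ?_ (fun k hk => hF k hk v hv) u hu
  · simpa [E', hvA, huB] using this
  · have h1 : hammingNorm (E' v) ≤ #{u | E v u ≠ 0} := by
      refine card_le_card fun u hu => ?_
      simp only [mem_filter, mem_univ, true_and, E'] at hu ⊢
      intro h0
      simp [h0] at hu
    have h2 : κ / d * r ≤ κ * r := by
      refine mul_le_mul_of_nonneg_right ?_ (by positivity)
      exact div_le_self hκ (by exact_mod_cast hd0)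
    have h3 : (hammingNorm (E' v) : ℝ) ≤ #{u | E v u ≠ 0} := by exact_mod_cast h1
    exact h3.trans ((hrow v hvA).trans h2)

/-- Markov's inequality, with the nonzero entries counted row by row. -/
theorem card_heavy_mul_le {E : Fin r → Fin r → ZMod 2} {t : ℝ} :
    (#{v | t < (#{u | E v u ≠ 0} : ℝ)} : ℝ) * t ≤ #{p : Fin r × Fin r | E p.1 p.2 ≠ 0} := by
  have e : #{p : Fin r × Fin r | E p.1 p.2 ≠ 0} = ∑ v, #{u | E v u ≠ 0} := by
    simp only [card_filter]
    exact Fintype.sum_prod_type _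
  rw [e, ← nsmul_eq_mul, ← sum_const, Nat.cast_sum]
  refine (sum_le_sum fun v hv => (mem_filter.1 hv).2.le).trans
    (sum_le_sum_of_subset_of_nonneg (filter_subset _ _) fun _ _ _ => by positivity)

theorem rowColDist_le (f g : Matrix (Fin r) (Fin r) (ZMod 2)) {w : Matrix (Fin r) (Fin r) (ZMod 2)}
    (hw : w ∈ tensorCode C) : rowColDist C f g ≤ 1 / 2 * (rowDist f w + colDist g w) := by
  unfold rowColDist
  refine mul_le_mul_of_nonneg_left (csInf_le ?_ ⟨w, hw, rfl⟩) (by norm_num)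
  refine ⟨0, ?_⟩
  rintro _ ⟨w, -, rfl⟩
  unfold rowDist colDist
  positivity

theorem zero_mem_tensorCode : (0 : Matrix (Fin r) (Fin r) (ZMod 2)) ∈ tensorCode C :=
  ⟨fun _ => C.zero_mem, fun _ => C.zero_mem⟩

theorem rowColDist_le_one (f g : Matrix (Fin r) (Fin r) (ZMod 2)) : rowColDist C f g ≤ 1 := by
  have h1 : ∀ w : Matrix (Fin r) (Fin r) (ZMod 2), rowDist f w ≤ 1 := fun w =>
    div_le_one_of_le₀ (by exact_mod_cast (card_filter_le _ _).trans (by simp)) (by positivity)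
  have h2 : ∀ w : Matrix (Fin r) (Fin r) (ZMod 2), colDist g w ≤ 1 := fun w =>
    div_le_one_of_le₀ (by exact_mod_cast (card_filter_le _ _).trans (by simp)) (by positivity)
  linarith [rowColDist_le (C := C) f g zero_mem_tensorCode, h1 0, h2 0]

theorem rowColDist_pos (hr : 0 < r) {f g : Matrix (Fin r) (Fin r) (ZMod 2)} (hfg : f ≠ g) :
    0 < rowColDist C f g := by
  have hfin : ((fun w => rowDist f w + colDist g w) '' tensorCode C).Finite :=
    (Set.toFinite (tensorCode C)).image _
  obtain ⟨w, -, hw⟩ :=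
    Set.Nonempty.csInf_mem (Set.Nonempty.image _ ⟨0, zero_mem_tensorCode (C := C)⟩) hfin
  unfold rowColDist
  rw [← hw]
  have h1 : 0 ≤ rowDist f w := by unfold rowDist; positivity
  have h2 : 0 ≤ colDist g w := by unfold colDist; positivity
  have hr' : (r : ℝ) ≠ 0 := by positivity
  by_contra hcon
  simp only [not_lt] at hcon
  have h3 : rowDist f w = 0 := by linarith
  have h4 : colDist g w = 0 := by linarith
  simp only [rowDist, div_eq_zero_iff, hr', or_false, Nat.cast_eq_zero, card_eq_zero,
    filter_eq_empty_iff, mem_univ, true_imp_iff, not_not] at h3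
  simp only [colDist, div_eq_zero_iff, hr', or_false, Nat.cast_eq_zero, card_eq_zero,
    filter_eq_empty_iff, mem_univ, true_imp_iff, not_not] at h4
  refine hfg (Matrix.ext fun v u => ?_)
  exact (congrFun (h3 (x := v)) u).trans (congrFun (h4 (x := u)) v).symm

/-- Guards against the convention `sInf ∅ = 0`, under which no positive lower bound on the
testability could hold. -/
theorem exists_pair_ne (hr : 0 < r) (hC : C ≠ ⊥) : ∃ f ∈ rowCode C, ∃ g ∈ colCode C, f ≠ g := by
  obtain ⟨c, hc, hc0⟩ := C.ne_bot_iff.1 hC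
  refine ⟨fun _ => c, fun _ => hc, 0, fun _ => C.zero_mem, fun h => hc0 ?_⟩
  exact congrFun h ⟨0, hr⟩

/-- The tensor code of a smooth low-density code is agreement testable. -/
theorem IsSmooth.le_agreementTestability (hH : IsSmooth H α K κ)
    (hC : ∀ x, x ∈ C ↔ H.mulVec x = 0) (hC0 : C ≠ ⊥) (hr : 0 < r) {d : ℕ}
    (hd : ∀ j, #{v | H j v ≠ 0} ≤ d) (hd0 : 0 < d) (hα : 0 < α) (hK : 0 < K) (hκ : 0 < κ) :
    min (min (κ / d * α) (κ / d * κ / K)) (κ / d / K) ≤ agreementTestability C := by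
  have hd' : (0 : ℝ) < d := by exact_mod_cast hd0
  have hr' : (0 : ℝ) < r := by exact_mod_cast hr
  obtain ⟨f₀, hf₀, g₀, hg₀, hne₀⟩ := exists_pair_ne hr hC0
  refine le_csInf ⟨_, f₀, hf₀, g₀, hg₀, hne₀, rfl⟩ ?_
  rintro _ ⟨f, hf, g, hg, hfg, rfl⟩
  rw [le_div_iff₀ (rowColDist_pos hr hfg)]
  set θ : ℝ := κ / d with hθ
  have hθ0 : 0 < θ := by positivity
  set τ := entryDist f g with hτ
  have hτ0 : 0 ≤ τ := by rw [hτ]; unfold entryDist; positivity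
  have hρ0 := (rowColDist_pos (C := C) hr hfg).le
  have hρ1 := rowColDist_le_one (C := C) f g
  set ρ := rowColDist C f g with hρ
  -- If `f` and `g` differ a lot, the trivial bound `ρ ≤ 1` suffices. Otherwise `τ < θ * α` makes
  -- the heavy sets small enough for smoothness, and `τ < θ * κ / K` keeps `A'` and `B'` below the
  -- minimum distance.
  by_cases hbig : min (θ * α) (θ * κ / K) ≤ τ
  · calc min (min (θ * α) (θ * κ / K)) (θ / K) * ρ
        ≤ τ * 1 := mul_le_mul ((min_le_left _ _).trans hbig) hρ1 hρ0 hτ0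
      _ = τ := mul_one τ
  · have hlt := not_le.1 hbig
    obtain ⟨h1, h2⟩ := lt_min_iff.1 hlt
    set E : Matrix (Fin r) (Fin r) (ZMod 2) := f - g with hEdef
    have hT : (#{p : Fin r × Fin r | E p.1 p.2 ≠ 0} : ℝ) = τ * r ^ 2 := by
      have : #{p : Fin r × Fin r | E p.1 p.2 ≠ 0} =
          #{p : Fin r × Fin r | f p.1 p.2 ≠ g p.1 p.2} := by
        congr 1
        ext p
        simp [hEdef, sub_eq_zero]
      rw [this, hτ, entryDist]
      field_simp
    have hT' : (#{p : Fin r × Fin r | E p.2 p.1 ≠ 0} : ℝ) = τ * r ^ 2 := by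
      rw [← hT]
      norm_cast
      exact card_equiv (Equiv.prodComm _ _) (by simp)
    set A : Finset (Fin r) := {v | θ * r < (#{u | E v u ≠ 0} : ℝ)} with hAdef
    set B : Finset (Fin r) := {u | θ * r < (#{v | E v u ≠ 0} : ℝ)} with hBdef
    have hAc : (#A : ℝ) ≤ τ / θ * r := by
      have h := card_heavy_mul_le (E := E) (t := θ * r)
      rw [hT] at h
      have h' : (#A : ℝ) * (θ * r) ≤ (τ / θ * r) * (θ * r) := by
        refine h.trans (le_of_eq ?_)
        field_simp
      exact le_of_mul_le_mul_right h' (by positivity)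
    have hBc : (#B : ℝ) ≤ τ / θ * r := by
      have h := card_heavy_mul_le (E := fun u v => E v u) (t := θ * r)
      rw [hT'] at h
      have h' : (#B : ℝ) * (θ * r) ≤ (τ / θ * r) * (θ * r) := by
        refine h.trans (le_of_eq ?_)
        field_simp
      exact le_of_mul_le_mul_right h' (by positivity)
    have hτα : τ / θ ≤ α := by
      rw [div_le_iff₀ hθ0]
      linarith
    have hle : τ / θ * r ≤ α * r := mul_le_mul_of_nonneg_right hτα hr'.le
    -- Check `k` kills the rows of `f`, and check `j` kills the columns of `g`.
    have hEsum : ∀ j k, ∑ v, H j v * ∑ u, E v u * H k u = 0 := by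
      intro j k
      have e1 : ∀ v, ∑ u, f v u * H k u = 0 := fun v => by
        rw [← (mem_iff_sum hC _).1 (hf v) k]
        exact sum_congr rfl fun u _ => mul_comm _ _
      have e2 : ∑ v, H j v * ∑ u, g v u * H k u = 0 := by
        simp only [mul_sum]
        rw [sum_comm]
        refine sum_eq_zero fun u _ => ?_
        have := (mem_iff_sum hC _).1 (hg u) j
        simp only [← mul_assoc, ← sum_mul]
        rw [show ∑ v, H j v * g v u = 0 from this, zero_mul]
      simp only [hEdef, Matrix.sub_apply, sub_mul, sum_sub_distrib, mul_sub, e1, e2]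
      simp
    obtain ⟨A', B', hA', hB', hsupp⟩ := hH.exists_support hd hd0 hκ.le hEsum (hAc.trans hle)
      (hBc.trans hle) (fun v hv => by simpa [hAdef] using hv) (fun u hu => by simpa [hBdef] using hu)
    have hA'' : (#A' : ℝ) ≤ K * (τ / θ * r) := hA'.trans (mul_le_mul_of_nonneg_left hAc hK.le)
    have hB'' : (#B' : ℝ) ≤ K * (τ / θ * r) := hB'.trans (mul_le_mul_of_nonneg_left hBc hK.le)
    have hκτ : K * (τ / θ * r) ≤ κ * r := by
      rw [← mul_assoc]
      refine mul_le_mul_of_nonneg_right ?_ hr'.le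
      rw [lt_div_iff₀ hK] at h2
      rw [mul_div_assoc', div_le_iff₀ hθ0]
      linarith
    have hdet : ∀ S : Finset (Fin r), (#S : ℝ) ≤ κ * r → ∀ c ∈ C, (∀ v ∉ S, c v = 0) → c = 0 :=
      fun S hS c hc h0 => hH.eq_zero_of_weight_le hα.le hC hc
        (le_trans (by exact_mod_cast hammingNorm_le_card h0) hS)
    obtain ⟨w, hw, hwr, hwc⟩ := exists_tensorCode_of_agree (hdet A' (hA''.trans hκτ))
      (hdet B' (hB''.trans hκτ)) hf hg fun v hv u hu => sub_eq_zero.1 (hsupp v hv u hu)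
    have hrd : rowDist f w ≤ K * (τ / θ) := by
      rw [rowDist, div_le_iff₀ hr', mul_assoc]
      refine le_trans ?_ hA''
      norm_cast
      refine card_le_card fun v hv => ?_
      by_contra hvA
      exact (mem_filter.1 hv).2 (hwr v hvA)
    have hcd : colDist g w ≤ K * (τ / θ) := by
      rw [colDist, div_le_iff₀ hr', mul_assoc]
      refine le_trans ?_ hB''
      norm_cast
      refine card_le_card fun u hu => ?_
      by_contra huB
      exact (mem_filter.1 hu).2 (hwc u huB)
    have hρle : ρ ≤ K * (τ / θ) := (rowColDist_le f g hw).trans (by linarith)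
    calc min (min (θ * α) (θ * κ / K)) (θ / K) * ρ
        ≤ θ / K * (K * (τ / θ)) :=
          mul_le_mul (min_le_right _ _) hρle hρ0 (by positivity)
      _ = τ := by field_simp

theorem IsSmooth.le_normDist (hH : IsSmooth H α K κ) (hα : 0 ≤ α)
    (hC : ∀ x, x ∈ C ↔ H.mulVec x = 0) (hC0 : C ≠ ⊥) (hr : 0 < r) : κ ≤ normDist C := by
  have hr' : (0 : ℝ) < r := by exact_mod_cast hr
  obtain ⟨c, hc, hc0⟩ := C.ne_bot_iff.1 hC0
  obtain ⟨x, hx, hx0, hxw⟩ := Nat.sInf_mem (s := {w : ℕ | ∃ c ∈ C, c ≠ 0 ∧ hammingNorm c = w})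
    ⟨_, c, hc, hc0, rfl⟩
  rw [normDist, minDist, le_div_iff₀ hr', ← hxw]
  by_contra hcon
  exact hx0 (hH.eq_zero_of_weight_le hα hC hx (not_le.1 hcon).le)

end

end BaseCode

/-! ### Spectral gap of the torus action and expander mixing. -/

namespace BaseCode

open Finset

theorem actWord_cons {N : ℕ} (g : Fin 6) (w : List (Fin 6)) (p : ZMod N × ZMod N) :
    actWord (g :: w) p = actWord w (act g p) := rfl

section Torus

variable {N : ℕ} [NeZero N]

/-- Transporting a set by `σ` changes its mass by at most the total variation `δ`. -/
theorem sum_le_sum_add_of_maps {V : Type*} [Fintype V] [DecidableEq V] {ν : V → ℝ}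
    (hν : ∀ z, 0 ≤ ν z) (σ : V ≃ V) {δ : ℝ} (hσ : ∑ z, |ν (σ z) - ν z| ≤ δ) {P Q : Finset V}
    (h : ∀ z ∈ P, σ z ∈ Q) : ∑ z ∈ P, ν z ≤ ∑ z ∈ Q, ν z + δ := by
  have h1 : ∑ z ∈ P, ν (σ z) ≤ ∑ z ∈ Q, ν z := by
    rw [show ∑ z ∈ P, ν (σ z) = ∑ z ∈ P.map σ.toEmbedding, ν z from
      (sum_map P σ.toEmbedding ν).symm]
    refine sum_le_sum_of_subset_of_nonneg (fun z hz => ?_) fun z _ _ => hν z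
    obtain ⟨y, hy, rfl⟩ := mem_map.1 hz
    exact h y hy
  have h2 : ∑ z ∈ P, (ν z - ν (σ z)) ≤ δ := by
    refine le_trans (sum_le_sum fun z _ => ?_)
      ((sum_le_sum_of_subset_of_nonneg (subset_univ P) fun z _ _ => abs_nonneg _).trans hσ)
    rw [abs_sub_comm]
    exact le_abs_self _
  rw [sum_sub_distrib] at h2
  linarith

theorem sum_abs_symm_sub {V : Type*} [Fintype V] {ν : V → ℝ} (σ : V ≃ V) :
    ∑ z, |ν (σ.symm z) - ν z| = ∑ z, |ν (σ z) - ν z| := by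
  rw [← σ.sum_comp]
  simp only [Equiv.symm_apply_apply, abs_sub_comm]

/-- The shear that subtracts the first coordinate from the second. -/
def shearSnd (N : ℕ) : ZMod N × ZMod N ≃ ZMod N × ZMod N where
  toFun z := (z.1, z.2 - z.1)
  invFun z := (z.1, z.2 + z.1)
  left_inv z := by simp
  right_inv z := by simp

/-- The shear that subtracts the second coordinate from the first. -/
def shearFst (N : ℕ) : ZMod N × ZMod N ≃ ZMod N × ZMod N where
  toFun z := (z.1 - z.2, z.2)
  invFun z := (z.1 + z.2, z.2)
  left_inv z := by simp
  right_inv z := by simp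

/-- The representative of least absolute value lies in the open quarter interval. -/
def Small (a : ZMod N) : Prop := 4 * a.valMinAbs < N ∧ -(N : ℤ) < 4 * a.valMinAbs

/-- Below a quarter of `N` there is no wrap-around, so the sectors of the plane may be treated as
over `ℤ`. -/
theorem valMinAbs_sub_of_small {a b : ZMod N} (ha : Small a) (hb : Small b) :
    (a - b).valMinAbs = a.valMinAbs - b.valMinAbs := by
  rw [ZMod.valMinAbs_spec]
  unfold Small at ha hb
  refine ⟨by simp, ?_, ?_⟩ <;> omega

theorem valMinAbs_add_of_small {a b : ZMod N} (ha : Small a) (hb : Small b) :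
    (a + b).valMinAbs = a.valMinAbs + b.valMinAbs := by
  rw [ZMod.valMinAbs_spec]
  unfold Small at ha hb
  refine ⟨by simp, ?_, ?_⟩ <;> omega

open Classical in
/-- The mass of the points whose coordinates, as integers of least absolute value, satisfy `P`. -/
noncomputable def mass (ν : ZMod N × ZMod N → ℝ) (P : ℤ → ℤ → Prop) : ℝ :=
  ∑ z ∈ univ.filter (fun z : ZMod N × ZMod N => P z.1.valMinAbs z.2.valMinAbs), ν z

/-- A nearly shear-invariant measure on the torus without atom at the origin lives mostly away
from the origin. -/
theorem sum_le_of_shear_invariant {ν : ZMod N × ZMod N → ℝ} (hν : ∀ z, 0 ≤ ν z) (h0 : ν 0 = 0)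
    {δ ω : ℝ} (h1 : ∑ z, |ν (shearSnd N z) - ν z| ≤ δ) (h2 : ∑ z, |ν (shearFst N z) - ν z| ≤ δ)
    (hω : mass ν (fun a b => ¬((4 * a < N ∧ -(N : ℤ) < 4 * a) ∧ 4 * b < N ∧ -(N : ℤ) < 4 * b)) ≤ ω) :
    ∑ z, ν z ≤ 10 * δ + 5 * ω := by
  classical
  set S : ℤ → Prop := fun a => 4 * a < N ∧ -(N : ℤ) < 4 * a with hS
  have hmono : ∀ P Q R : ℤ → ℤ → Prop, (∀ a b, P a b → Q a b ∨ R a b) →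
      mass ν P ≤ mass ν Q + mass ν R := by
    intro P Q R h
    unfold mass
    refine (sum_le_sum_of_subset_of_nonneg (t := univ.filter
      (fun z : ZMod N × ZMod N => Q z.1.valMinAbs z.2.valMinAbs) ∪ univ.filter
      (fun z : ZMod N × ZMod N => R z.1.valMinAbs z.2.valMinAbs)) (fun z hz => ?_)
      fun z _ _ => hν z).trans ?_
    · simp only [mem_union, mem_filter, mem_univ, true_and] at hz ⊢
      exact h _ _ hz
    · rw [← sum_union_inter]
      exact le_add_of_nonneg_right (sum_nonneg fun z _ => hν z)
  have hdisj : ∀ P Q R T : ℤ → ℤ → Prop, (∀ a b, P a b → Q a b → False) →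
      (∀ a b, P a b ∨ Q a b → R a b ∨ T a b) → mass ν P + mass ν Q ≤ mass ν R + mass ν T := by
    intro P Q R T h h'
    refine le_trans (le_of_eq ?_) (hmono (fun a b => P a b ∨ Q a b) R T h')
    unfold mass
    rw [← sum_union]
    · congr 1
      ext z
      simp
    · rw [disjoint_filter]
      exact fun z _ h1 h2 => h _ _ h1 h2
  have hmap : ∀ (σ : ZMod N × ZMod N ≃ ZMod N × ZMod N), ∑ z, |ν (σ z) - ν z| ≤ δ →
      ∀ P Q : ℤ → ℤ → Prop, (∀ z, P z.1.valMinAbs z.2.valMinAbs →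
        Q (σ z).1.valMinAbs (σ z).2.valMinAbs) → mass ν P ≤ mass ν Q + δ := by
    intro σ hσ P Q h
    refine sum_le_sum_add_of_maps hν σ hσ fun z hz => ?_
    simp only [mem_filter, mem_univ, true_and] at hz ⊢
    exact h z hz
  have h1' := (sum_abs_symm_sub (ν := ν) (shearSnd N)).trans_le h1
  have h2' := (sum_abs_symm_sub (ν := ν) (shearFst N)).trans_le h2
  -- The box around the origin is split into points with coordinates of opposite sign, of equal
  -- sign, the two punctured axes, and the origin.
  set out : ℤ → ℤ → Prop := fun a b => ¬(S a ∧ S b)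
  set neg : ℤ → ℤ → Prop := fun a b => (S a ∧ S b) ∧ ((0 < a ∧ b < 0) ∨ (a < 0 ∧ 0 < b))
  set pos : ℤ → ℤ → Prop := fun a b => (S a ∧ S b) ∧ ((0 < a ∧ 0 < b) ∨ (a < 0 ∧ b < 0))
  set hor : ℤ → ℤ → Prop := fun a b => (S a ∧ S b) ∧ (a ≠ 0 ∧ b = 0)
  set ver : ℤ → ℤ → Prop := fun a b => (S a ∧ S b) ∧ (a = 0 ∧ b ≠ 0)
  -- With opposite signs, each shear adds the absolute values of the two coordinates. The two images
  -- of `neg` are therefore disjoint parts of `neg` and `out`, whence `2 * neg ≤ neg + out + 2 * δ`.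
  -- For equal signs the inverse shears do the same.
  have n1 := hmap _ h1 neg (fun a b => (0 < a ∧ b < 0 ∧ a < -b) ∨ (a < 0 ∧ 0 < b ∧ -a < b))
    fun z ⟨⟨ha, hb⟩, h⟩ => by
      simp only [shearSnd, Equiv.coe_fn_mk, valMinAbs_sub_of_small hb ha]
      omega
  have n2 := hmap _ h2 neg (fun a b => (0 < a ∧ b < 0 ∧ -b < a) ∨ (a < 0 ∧ 0 < b ∧ b < -a))
    fun z ⟨⟨ha, hb⟩, h⟩ => by
      simp only [shearFst, Equiv.coe_fn_mk, valMinAbs_sub_of_small ha hb]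
      omega
  have n3 := hdisj _ _ neg out (fun a b (h : (0 < a ∧ b < 0 ∧ a < -b) ∨ (a < 0 ∧ 0 < b ∧ -a < b))
    (h' : (0 < a ∧ b < 0 ∧ -b < a) ∨ (a < 0 ∧ 0 < b ∧ b < -a)) => by omega) fun a b h => by
      by_cases hS : S a ∧ S b
      · exact Or.inl ⟨hS, by omega⟩
      · exact Or.inr hS
  have p1 := hmap _ h1' pos (fun a b => (0 < a ∧ 0 < b ∧ a < b) ∨ (a < 0 ∧ b < 0 ∧ b < a))
    fun z ⟨⟨ha, hb⟩, h⟩ => by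
      simp only [shearSnd, Equiv.coe_fn_symm_mk, valMinAbs_add_of_small hb ha]
      omega
  have p2 := hmap _ h2' pos (fun a b => (0 < a ∧ 0 < b ∧ b < a) ∨ (a < 0 ∧ b < 0 ∧ a < b))
    fun z ⟨⟨ha, hb⟩, h⟩ => by
      simp only [shearFst, Equiv.coe_fn_symm_mk, valMinAbs_add_of_small ha hb]
      omega
  have p3 := hdisj _ _ pos out (fun a b (h : (0 < a ∧ 0 < b ∧ a < b) ∨ (a < 0 ∧ b < 0 ∧ b < a))
    (h' : (0 < a ∧ 0 < b ∧ b < a) ∨ (a < 0 ∧ b < 0 ∧ a < b)) => by omega) fun a b h => by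
      by_cases hS : S a ∧ S b
      · exact Or.inl ⟨hS, by omega⟩
      · exact Or.inr hS
  -- A shear moves a punctured axis to an antidiagonal, which has opposite signs.
  have x1 := hmap _ h1 hor neg fun z ⟨⟨ha, hb⟩, h⟩ => by
    simp only [shearSnd, Equiv.coe_fn_mk, valMinAbs_sub_of_small hb ha, neg, hS] at ha hb h ⊢
    omega
  have y1 := hmap _ h2 ver neg fun z ⟨⟨ha, hb⟩, h⟩ => by
    simp only [shearFst, Equiv.coe_fn_mk, valMinAbs_sub_of_small ha hb, neg, hS] at ha hb h ⊢
    omega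
  have z0 : mass ν (fun a b => a = 0 ∧ b = 0) = 0 := by
    refine sum_eq_zero fun z hz => ?_
    simp only [mem_filter, mem_univ, true_and, ZMod.valMinAbs_eq_zero] at hz
    rw [show z = 0 from Prod.ext hz.1 hz.2, h0]
  have t1 := hmono (fun _ _ => True) out (fun a b => S a ∧ S b) fun a b _ =>
    (Classical.em (S a ∧ S b)).symm
  have t2 := hmono (fun a b => S a ∧ S b) neg (fun a b => (S a ∧ S b) ∧
    ¬((0 < a ∧ b < 0) ∨ (a < 0 ∧ 0 < b))) fun a b h => by
      by_cases h' : (0 < a ∧ b < 0) ∨ (a < 0 ∧ 0 < b)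
      · exact Or.inl ⟨h, h'⟩
      · exact Or.inr ⟨h, h'⟩
  have t3 := hmono (fun a b => (S a ∧ S b) ∧ ¬((0 < a ∧ b < 0) ∨ (a < 0 ∧ 0 < b))) pos
    (fun a b => (S a ∧ S b) ∧ (a = 0 ∨ b = 0)) fun a b h => by
      by_cases h' : a = 0 ∨ b = 0
      · exact Or.inr ⟨h.1, h'⟩
      · exact Or.inl ⟨h.1, by omega⟩
  have t4 := hmono (fun a b => (S a ∧ S b) ∧ (a = 0 ∨ b = 0)) hor
    (fun a b => (S a ∧ S b) ∧ a = 0) fun a b h => by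
      by_cases h' : a = 0
      · exact Or.inr ⟨h.1, h'⟩
      · exact Or.inl ⟨h.1, by omega⟩
  have t5 := hmono (fun a b => (S a ∧ S b) ∧ a = 0) ver (fun a b => a = 0 ∧ b = 0) fun a b h => by
      by_cases h' : b = 0
      · exact Or.inr ⟨h.2, h'⟩
      · exact Or.inl ⟨h.1, by omega⟩
  -- Bounds to be added: `ω` outside the box, `ω + 2 * δ` for each of `neg` and `pos`, `ω + 3 * δ`
  -- for each axis, and `0` at the origin.
  have tot : mass ν (fun _ _ => True) = ∑ z, ν z := by simp [mass]
  rw [← tot]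
  linarith

/-- The unnormalized Fourier transform on the torus. -/
noncomputable def fourier (f : ZMod N × ZMod N → ℂ) (z : ZMod N × ZMod N) : ℂ :=
  ∑ p, f p * ZMod.stdAddChar (z.1 * p.1 + z.2 * p.2)

theorem sum_char (p : ZMod N × ZMod N) :
    ∑ z : ZMod N × ZMod N, (ZMod.stdAddChar (z.1 * p.1 + z.2 * p.2) : ℂ) =
      if p = 0 then (N : ℂ) ^ 2 else 0 := by
  have h := fun b : ZMod N =>
    AddChar.sum_mulShift b (ZMod.isPrimitive_stdAddChar N)
  rw [Fintype.sum_prod_type]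
  simp only [AddChar.map_add_eq_mul, ← mul_sum, ← sum_mul, h]
  by_cases h1 : p.1 = 0 <;> by_cases h2 : p.2 = 0 <;>
    simp [h1, h2, Prod.ext_iff, ZMod.card, sq]

theorem fourier_sub (f g : ZMod N × ZMod N → ℂ) (z : ZMod N × ZMod N) :
    fourier (fun p => f p - g p) z = fourier f z - fourier g z := by
  simp [fourier, sub_mul]

/-- Plancherel: after expanding the square, orthogonality of characters leaves only the diagonal. -/
theorem sum_norm_fourier_sq (f : ZMod N × ZMod N → ℂ) :
    ∑ z, ‖fourier f z‖ ^ 2 = (N : ℝ) ^ 2 * ∑ p, ‖f p‖ ^ 2 := by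
  have h : ∀ w : ℂ, ((‖w‖ ^ 2 : ℝ) : ℂ) = w * (starRingEnd ℂ) w := fun w => by
    rw [Complex.mul_conj, Complex.normSq_eq_norm_sq]
  have key : ((∑ z, ‖fourier f z‖ ^ 2 : ℝ) : ℂ) = (((N : ℝ) ^ 2 * ∑ p, ‖f p‖ ^ 2 : ℝ) : ℂ) := by
    push_cast
    have e : ∀ z : ZMod N × ZMod N, ((‖fourier f z‖ : ℂ)) ^ 2 = ∑ p, ∑ q,
        f p * (starRingEnd ℂ) (f q) *
          ZMod.stdAddChar (z.1 * (p - q).1 + z.2 * (p - q).2) := fun z => by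
      have := h (fourier f z)
      push_cast at this
      rw [this, fourier, map_sum, sum_mul_sum]
      refine sum_congr rfl fun p _ => sum_congr rfl fun q _ => ?_
      rw [map_mul, ← AddChar.map_neg_eq_conj, mul_mul_mul_comm, ← AddChar.map_add_eq_mul]
      congr 2
      simp only [Prod.fst_sub, Prod.snd_sub]
      ring
    simp only [e]
    rw [sum_comm]
    simp only [mul_sum]
    refine sum_congr rfl fun p _ => ?_
    rw [sum_comm]
    simp only [← mul_sum, sum_char, sub_eq_zero, mul_ite, mul_zero]
    rw [sum_ite_eq univ p, if_pos (mem_univ _)]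
    have := h (f p)
    push_cast at this
    rw [this]
    ring
  exact_mod_cast key

theorem fourier_comp_equiv (f : ZMod N × ZMod N → ℂ) (σ : ZMod N × ZMod N ≃ ZMod N × ZMod N)
    (z : ZMod N × ZMod N) : fourier (fun p => f (σ p)) z =
      ∑ p, f p * ZMod.stdAddChar (z.1 * (σ.symm p).1 + z.2 * (σ.symm p).2) := by
  unfold fourier
  rw [← σ.sum_comp (fun p => f p * ZMod.stdAddChar (z.1 * (σ.symm p).1 + z.2 * (σ.symm p).2))]
  simp

/-- The angle is at least a quarter turn and at most a half turn. Such frequencies are moved far by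
a translation, so near invariance leaves little mass on them. -/
theorem re_stdAddChar_nonpos {a : ZMod N} (h : ¬(4 * a.valMinAbs < N ∧ -(N : ℤ) < 4 * a.valMinAbs)) :
    (ZMod.stdAddChar a : ℂ).re ≤ 0 := by
  have hN : (0 : ℝ) < N := by exact_mod_cast NeZero.pos N
  obtain ⟨h1, h2⟩ := a.valMinAbs_mem_Ioc
  have e : (ZMod.stdAddChar a : ℂ) =
      Complex.exp (((2 * Real.pi * a.valMinAbs / N : ℝ) : ℂ) * Complex.I) := by
    conv_lhs => rw [← a.coe_valMinAbs, ZMod.stdAddChar_coe]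
    congr 1
    push_cast
    ring
  rw [e, Complex.exp_ofReal_mul_I_re, ← Real.cos_abs]
  have hpi := Real.pi_pos
  have habs : |2 * Real.pi * a.valMinAbs / N| = 2 * Real.pi * (|a.valMinAbs| / N) := by
    rw [abs_div, abs_mul, abs_of_pos (by positivity : 0 < 2 * Real.pi), abs_of_pos hN, Int.cast_abs]
    ring
  rw [habs]
  have b1 : (1 : ℝ) / 4 ≤ |a.valMinAbs| / N := by
    rw [div_le_div_iff₀ (by norm_num) hN]
    have : (N : ℤ) ≤ |a.valMinAbs| * 4 := by
      rcases abs_cases a.valMinAbs with ⟨h, _⟩ | ⟨h, _⟩ <;> rw [h] <;> omega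
    have := (Int.cast_le (R := ℝ)).2 this
    push_cast at this ⊢
    linarith
  have b2 : ((|a.valMinAbs| : ℤ) : ℝ) / N ≤ 1 / 2 := by
    rw [div_le_div_iff₀ hN (by norm_num)]
    have : |a.valMinAbs| * 2 ≤ (N : ℤ) := by
      rcases abs_cases a.valMinAbs with ⟨h, _⟩ | ⟨h, _⟩ <;> rw [h] <;> omega
    have := (Int.cast_le (R := ℝ)).2 this
    push_cast at this ⊢
    linarith
  apply Real.cos_nonpos_of_pi_div_two_le_of_le <;> nlinarith

/-- The generating maps are permutations of the torus. -/
def actEquiv (N : ℕ) (g : Fin 6) : ZMod N × ZMod N ≃ ZMod N × ZMod N where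
  toFun := act g
  invFun p :=
    match g with
    | 0 => (p.1 - 1, p.2)
    | 1 => (p.1, p.2 - 1)
    | 2 => (p.1 - p.2, p.2)
    | 3 => (p.1, p.2 - p.1)
    | _ => p
  left_inv p := by fin_cases g <;> simp [act]
  right_inv p := by fin_cases g <;> simp [act]

theorem fourier_act_zero (f : ZMod N × ZMod N → ℂ) (z : ZMod N × ZMod N) :
    fourier (fun p => f (act 0 p)) z = ZMod.stdAddChar (-z.1) * fourier f z := by
  refine (fourier_comp_equiv f (actEquiv N 0) z).trans ?_
  rw [fourier, mul_sum]
  refine sum_congr rfl fun p _ => ?_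
  rw [mul_left_comm, ← AddChar.map_add_eq_mul]
  congr 2
  simp only [actEquiv, Equiv.coe_fn_symm_mk]
  ring

theorem fourier_act_one (f : ZMod N × ZMod N → ℂ) (z : ZMod N × ZMod N) :
    fourier (fun p => f (act 1 p)) z = ZMod.stdAddChar (-z.2) * fourier f z := by
  refine (fourier_comp_equiv f (actEquiv N 1) z).trans ?_
  rw [fourier, mul_sum]
  refine sum_congr rfl fun p _ => ?_
  rw [mul_left_comm, ← AddChar.map_add_eq_mul]
  congr 2
  simp only [actEquiv, Equiv.coe_fn_symm_mk]
  ring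

/-- A shear acts on frequencies by its inverse transpose, again a shear. -/
theorem fourier_act_two (f : ZMod N × ZMod N → ℂ) (z : ZMod N × ZMod N) :
    fourier (fun p => f (act 2 p)) z = fourier f (shearSnd N z) := by
  refine (fourier_comp_equiv f (actEquiv N 2) z).trans ?_
  refine sum_congr rfl fun p _ => ?_
  congr 2
  simp only [actEquiv, shearSnd, Equiv.coe_fn_symm_mk, Equiv.coe_fn_mk]
  ring

theorem fourier_act_three (f : ZMod N × ZMod N → ℂ) (z : ZMod N × ZMod N) :
    fourier (fun p => f (act 3 p)) z = fourier f (shearFst N z) := by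
  refine (fourier_comp_equiv f (actEquiv N 3) z).trans ?_
  refine sum_congr rfl fun p _ => ?_
  congr 2
  simp only [actEquiv, shearFst, Equiv.coe_fn_symm_mk, Equiv.coe_fn_mk]
  ring

/-- Pointwise, the difference of squares is at most `c * (a + b)`, which is split by weighted AM–GM.
The first part contributes `1 / 2 * η` and the second `2 * η`, hence `5 / 2`. -/
theorem sum_abs_norm_sq_sub_le {V : Type*} [Fintype V] (F : V → ℂ) (σ : V ≃ V) {η : ℝ} (hη : 0 < η)
    (h : ∑ z, ‖F (σ z) - F z‖ ^ 2 ≤ η ^ 2 * ∑ z, ‖F z‖ ^ 2) :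
    ∑ z, |‖F (σ z)‖ ^ 2 - ‖F z‖ ^ 2| ≤ 5 / 2 * η * ∑ z, ‖F z‖ ^ 2 := by
  have hpt : ∀ z, |‖F (σ z)‖ ^ 2 - ‖F z‖ ^ 2| ≤
      (1 / (2 * η)) * ‖F (σ z) - F z‖ ^ 2 + η * (‖F (σ z)‖ ^ 2 + ‖F z‖ ^ 2) := fun z => by
    have h1 := abs_norm_sub_norm_le (F (σ z)) (F z)
    set a := ‖F (σ z)‖
    set b := ‖F z‖
    set c := ‖F (σ z) - F z‖
    have ha : 0 ≤ a := norm_nonneg _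
    have hb : 0 ≤ b := norm_nonneg _
    have hc : 0 ≤ c := norm_nonneg _
    have h2 : |a ^ 2 - b ^ 2| ≤ c * (a + b) := by
      rw [sq_sub_sq, abs_mul, abs_of_nonneg (by positivity : 0 ≤ a + b), mul_comm]
      exact mul_le_mul_of_nonneg_right h1 (by positivity)
    refine h2.trans ?_
    have h3 : (1 / (2 * η)) * c ^ 2 + η * (a ^ 2 + b ^ 2) - c * (a + b) =
        (1 / (2 * η)) * ((c - η * (a + b)) ^ 2 + η ^ 2 * (a - b) ^ 2) := by
      field_simp
      ring
    have h4 : 0 ≤ (1 / (2 * η)) * ((c - η * (a + b)) ^ 2 + η ^ 2 * (a - b) ^ 2) := by positivity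
    linarith
  refine (sum_le_sum fun z _ => hpt z).trans ?_
  rw [sum_add_distrib, ← mul_sum, ← mul_sum, sum_add_distrib,
    σ.sum_comp (fun z => ‖F z‖ ^ 2)]
  have := mul_le_mul_of_nonneg_left h (by positivity : 0 ≤ 1 / (2 * η))
  have e : 1 / (2 * η) * (η ^ 2 * ∑ z, ‖F z‖ ^ 2) = 1 / 2 * η * ∑ z, ‖F z‖ ^ 2 := by
    field_simp
  linarith

theorem norm_sub_one_mul_sq (a : ZMod N) (w : ℂ) :
    ‖ZMod.stdAddChar (-a) * w - w‖ ^ 2 = (2 - 2 * (ZMod.stdAddChar a : ℂ).re) * ‖w‖ ^ 2 := by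
  have h1 : ZMod.stdAddChar (-a) * w - w = (ZMod.stdAddChar (-a) - 1) * w := by ring
  have h2 : ‖(ZMod.stdAddChar a : ℂ)‖ ^ 2 = 1 := by
    rw [ZMod.stdAddChar_apply, Circle.norm_coe, one_pow]
  rw [h1, norm_mul, mul_pow, AddChar.map_neg_eq_conj]
  congr 1
  rw [← Complex.normSq_eq_norm_sq, Complex.normSq_apply] at h2 ⊢
  simp only [Complex.sub_re, Complex.conj_re, Complex.one_re, Complex.sub_im, Complex.conj_im,
    Complex.one_im]
  linarith

/-- No nonzero function of mean zero on the torus is nearly invariant under the generating maps. -/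
theorem eq_zero_of_nearly_invariant {f : ZMod N × ZMod N → ℂ} (hf : ∑ p, f p = 0)
    (h : ∀ g : Fin 6, ∑ p, ‖f (act g p) - f p‖ ^ 2 ≤ (1 / 40) ^ 2 * ∑ p, ‖f p‖ ^ 2) :
    ∑ p, ‖f p‖ ^ 2 = 0 := by
  classical
  have hN : (0 : ℝ) < (N : ℝ) ^ 2 := by
    have : (0 : ℝ) < N := by exact_mod_cast NeZero.pos N
    positivity
  set M := ∑ z, ‖fourier f z‖ ^ 2 with hM
  have hM' : M = (N : ℝ) ^ 2 * ∑ p, ‖f p‖ ^ 2 := sum_norm_fourier_sq f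
  have hM0 : 0 ≤ M := sum_nonneg fun z _ => by positivity
  have hF : ∀ g : Fin 6, ∑ z, ‖fourier (fun p => f (act g p)) z - fourier f z‖ ^ 2 ≤
      (1 / 40) ^ 2 * M := fun g => by
    simp only [← fourier_sub]
    rw [sum_norm_fourier_sq, hM']
    nlinarith [mul_le_mul_of_nonneg_left (h g) hN.le]
  have h0 := hF 0
  have h1 := hF 1
  have h2 := hF 2
  have h3 := hF 3
  simp only [fourier_act_zero, fourier_act_one, fourier_act_two, fourier_act_three,
    norm_sub_one_mul_sq] at h0 h1 h2 h3
  have hs1 := sum_abs_norm_sq_sub_le (fourier f) (shearSnd N) (by norm_num : (0 : ℝ) < 1 / 40) h2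
  have hs2 := sum_abs_norm_sq_sub_le (fourier f) (shearFst N) (by norm_num : (0 : ℝ) < 1 / 40) h3
  have hre : ∀ a : ZMod N, 0 ≤ 2 - 2 * (ZMod.stdAddChar a : ℂ).re := fun a => by
    have := Complex.re_le_norm (ZMod.stdAddChar a : ℂ)
    rw [ZMod.stdAddChar_apply, Circle.norm_coe] at this
    rw [ZMod.stdAddChar_apply]
    linarith
  -- Outside the box one of the two factors `2 - 2 * re` is at least `2`, so half the sum of the two
  -- translation defects dominates the mass there.
  have hout : mass (fun z => ‖fourier f z‖ ^ 2) (fun a b =>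
      ¬((4 * a < N ∧ -(N : ℤ) < 4 * a) ∧ 4 * b < N ∧ -(N : ℤ) < 4 * b)) ≤ (1 / 40) ^ 2 * M := by
    have hpt : ∀ z ∈ univ.filter (fun z : ZMod N × ZMod N =>
        ¬((4 * z.1.valMinAbs < N ∧ -(N : ℤ) < 4 * z.1.valMinAbs) ∧
          4 * z.2.valMinAbs < N ∧ -(N : ℤ) < 4 * z.2.valMinAbs)),
        ‖fourier f z‖ ^ 2 ≤ 1 / 2 * ((2 - 2 * (ZMod.stdAddChar z.1 : ℂ).re) * ‖fourier f z‖ ^ 2 +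
          (2 - 2 * (ZMod.stdAddChar z.2 : ℂ).re) * ‖fourier f z‖ ^ 2) := by
      intro z hz
      have hz' := (mem_filter.1 hz).2
      have hsq : 0 ≤ ‖fourier f z‖ ^ 2 := by positivity
      rw [not_and_or] at hz'
      rcases hz' with hz' | hz'
      · nlinarith [re_stdAddChar_nonpos hz', hre z.2, mul_nonneg (hre z.2) hsq,
          mul_nonneg (neg_nonneg.2 (re_stdAddChar_nonpos hz')) hsq]
      · nlinarith [re_stdAddChar_nonpos hz', hre z.1, mul_nonneg (hre z.1) hsq,
          mul_nonneg (neg_nonneg.2 (re_stdAddChar_nonpos hz')) hsq]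
    unfold mass
    refine (le_of_eq (by congr!)).trans ((sum_le_sum hpt).trans ?_)
    refine (sum_le_sum_of_subset_of_nonneg (subset_univ _) fun z _ _ => ?_).trans ?_
    · have := mul_nonneg (hre z.1) (sq_nonneg ‖fourier f z‖)
      have := mul_nonneg (hre z.2) (sq_nonneg ‖fourier f z‖)
      linarith
    · rw [← mul_sum, sum_add_distrib]
      linarith
  have hzero : ‖fourier f 0‖ ^ 2 = 0 := by simp [fourier, hf]
  have := sum_le_of_shear_invariant (ν := fun z => ‖fourier f z‖ ^ 2) (fun z => by positivity)
    hzero hs1 hs2 hout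
  rw [← hM] at this
  -- The bound reads `M ≤ (10 * (5 / 2) / 40 + 5 / 1600) * M = 201 / 320 * M`.
  have hMz : M = 0 := by nlinarith
  rw [hMz] at hM'
  exact (mul_eq_zero.1 hM'.symm).resolve_left hN.ne'

/-- Lagrange's identity: the defect in Cauchy–Schwarz is the sum of squared differences over all
pairs. Only the pair of `g` with the identity map, index `4`, is kept, so the defect measures
displacement. -/
theorem sq_sum_six_le (x : Fin 6 → ℝ) (g : Fin 6) :
    (∑ i, x i) ^ 2 ≤ 36 * ((∑ i, x i ^ 2) / 6) - (x g - x 4) ^ 2 := by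
  have key : 36 * ((∑ i, x i ^ 2) / 6) - (∑ i, x i) ^ 2 =
      ∑ i, (x i - x 4) ^ 2 + ((x 0 - x 1) ^ 2 + (x 0 - x 2) ^ 2 + (x 0 - x 3) ^ 2 +
        (x 0 - x 5) ^ 2 + (x 1 - x 2) ^ 2 + (x 1 - x 3) ^ 2 + (x 1 - x 5) ^ 2 + (x 2 - x 3) ^ 2 +
        (x 2 - x 5) ^ 2 + (x 3 - x 5) ^ 2) := by
    simp only [Fin.sum_univ_six]
    ring
  have h1 := single_le_sum (f := fun i => (x i - x 4) ^ 2) (fun i _ => sq_nonneg _) (mem_univ g)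
  have h2 : 0 ≤ (x 0 - x 1) ^ 2 + (x 0 - x 2) ^ 2 + (x 0 - x 3) ^ 2 +
        (x 0 - x 5) ^ 2 + (x 1 - x 2) ^ 2 + (x 1 - x 3) ^ 2 + (x 1 - x 5) ^ 2 + (x 2 - x 3) ^ 2 +
        (x 2 - x 5) ^ 2 + (x 3 - x 5) ^ 2 := by positivity
  linarith

/-- The sum of the generating maps contracts functions of mean zero. -/
theorem sum_sq_sum_act_le {f : ZMod N × ZMod N → ℝ} (hf : ∑ p, f p = 0) :
    ∑ p, (∑ g : Fin 6, f (act g p)) ^ 2 ≤ 36 * (1 - 1 / 57600) * ∑ p, f p ^ 2 := by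
  have hinv : ∀ g : Fin 6, ∑ p, f (act g p) ^ 2 = ∑ p, f p ^ 2 := fun g =>
    (actEquiv N g).sum_comp fun p => f p ^ 2
  have hbound : ∀ g : Fin 6, ∑ p, (∑ g : Fin 6, f (act g p)) ^ 2 ≤
      36 * ∑ p, f p ^ 2 - ∑ p, (f (act g p) - f p) ^ 2 := fun g => by
    refine (sum_le_sum fun p _ => sq_sum_six_le (fun i => f (act i p)) g).trans (le_of_eq ?_)
    rw [sum_sub_distrib, ← mul_sum, ← sum_div, sum_comm]
    simp only [hinv, sum_const, card_univ, Fintype.card_fin, nsmul_eq_mul]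
    have : ∀ p : ZMod N × ZMod N, act 4 p = p := fun p => rfl
    simp only [this]
    push_cast
    ring
  by_contra hcon
  -- If contraction fails, every displacement is at most `36 / 57600 = (1 / 40) ^ 2` of the squared
  -- norm.
  have hz := eq_zero_of_nearly_invariant (f := fun p => (f p : ℂ)) (by exact_mod_cast hf)
    fun g => by
      have e : ∀ x y : ℝ, ‖(x : ℂ) - y‖ ^ 2 = (x - y) ^ 2 := fun x y => by
        rw [← Complex.ofReal_sub, Complex.norm_real, Real.norm_eq_abs, sq_abs]
      simp only [e, Complex.norm_real, Real.norm_eq_abs, sq_abs]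
      have := hbound g
      linarith [not_le.1 hcon]
  simp only [Complex.norm_real, Real.norm_eq_abs, sq_abs] at hz
  have := hbound 4
  have h' : 0 ≤ ∑ p, (f (act 4 p) - f p) ^ 2 := sum_nonneg fun _ _ => sq_nonneg _
  rw [hz] at hcon this
  linarith

/-- The words of length `t` contract functions of mean zero. -/
theorem sum_sq_sum_actWord_le {f : ZMod N × ZMod N → ℝ} (hf : ∑ p, f p = 0) (t : ℕ) :
    ∑ p, (∑ w : Fin t → Fin 6, f (actWord (List.ofFn w) p)) ^ 2 ≤
      (36 * (1 - 1 / 57600)) ^ t * ∑ p, f p ^ 2 := by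
  have hsum : ∀ t, ∑ p, ∑ w : Fin t → Fin 6, f (actWord (List.ofFn w) p) = 0 := by
    intro t
    rw [sum_comm]
    refine sum_eq_zero fun w _ => ?_
    rw [← hf]
    generalize List.ofFn w = l
    induction l with
    | nil => rfl
    | cons g l ih =>
      rw [← ih]
      exact (actEquiv N g).sum_comp fun p => f (actWord l p)
  induction t with
  | zero => simp [actWord]
  | succ t ih =>
    have e : ∀ p : ZMod N × ZMod N, ∑ w : Fin (t + 1) → Fin 6, f (actWord (List.ofFn w) p) =
        ∑ g : Fin 6, (fun q => ∑ w : Fin t → Fin 6, f (actWord (List.ofFn w) q)) (act g p) :=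
      fun p => by
        rw [← (Fin.consEquiv fun _ => Fin 6).sum_comp, Fintype.sum_prod_type]
        refine sum_congr rfl fun g _ => sum_congr rfl fun w _ => ?_
        simp [List.ofFn_succ, actWord_cons]
    simp only [e]
    exact (sum_sq_sum_act_le (hsum t)).trans
      ((mul_le_mul_of_nonneg_left ih (by norm_num)).trans (le_of_eq (by ring)))

/-- Expander mixing for the action of the words of length `t`. -/
theorem card_edges_le (t : ℕ) (L R : Finset (ZMod N × ZMod N)) :
    (#{e : (ZMod N × ZMod N) × (Fin t → Fin 6) | e.1 ∈ L ∧ actWord (List.ofFn e.2) e.1 ∈ R} : ℝ) ≤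
      6 ^ t * ((#L : ℝ) * #R / N ^ 2 + √(1 - 1 / 57600) ^ t * √(#L * #R)) := by
  classical
  have hN : (0 : ℝ) < (N : ℝ) ^ 2 := by
    have : (0 : ℝ) < N := by exact_mod_cast NeZero.pos N
    positivity
  have hcard : (#(univ : Finset (ZMod N × ZMod N)) : ℝ) = (N : ℝ) ^ 2 := by
    simp [ZMod.card, sq]
  set c : ℝ := #R / N ^ 2 with hc
  -- The balanced indicator of `R`: the constant `c` gives the main term, and the mean-zero part is
  -- contracted after Cauchy–Schwarz on `L`.
  set f : ZMod N × ZMod N → ℝ := fun p => (if p ∈ R then 1 else 0) - c with hf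
  have hf0 : ∑ p, f p = 0 := by
    simp only [hf, sum_sub_distrib, sum_const, nsmul_eq_mul, hcard]
    simp [hc]
    field_simp
    simp
  have hf2 : ∑ p, f p ^ 2 ≤ #R := by
    have e : ∀ p, f p ^ 2 = (if p ∈ R then 1 else 0) - 2 * c * f p - c ^ 2 := fun p => by
      simp only [hf]
      split_ifs <;> ring
    simp only [e, sum_sub_distrib, ← mul_sum, hf0]
    simp
    positivity
  set G : ZMod N × ZMod N → ℝ := fun p => ∑ w : Fin t → Fin 6, f (actWord (List.ofFn w) p) with hG
  have hedge : (#{e : (ZMod N × ZMod N) × (Fin t → Fin 6) |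
      e.1 ∈ L ∧ actWord (List.ofFn e.2) e.1 ∈ R} : ℝ) = ∑ p ∈ L, G p + 6 ^ t * (#L * c) := by
    have h1 : ∀ p, G p = ∑ w : Fin t → Fin 6,
        (if actWord (List.ofFn w) p ∈ R then (1 : ℝ) else 0) - 6 ^ t * c := fun p => by
      simp only [hG, hf, sum_sub_distrib, sum_const, card_univ, nsmul_eq_mul]
      simp
    simp only [h1, sum_sub_distrib, sum_const, nsmul_eq_mul]
    rw [card_filter, Fintype.sum_prod_type]
    push_cast
    have h2 : ∀ p, ∑ w : Fin t → Fin 6,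
        (if p ∈ L ∧ actWord (List.ofFn w) p ∈ R then (1 : ℝ) else 0) = if p ∈ L then
          ∑ w : Fin t → Fin 6, (if actWord (List.ofFn w) p ∈ R then (1 : ℝ) else 0) else 0 :=
      fun p => by by_cases hp : p ∈ L <;> simp [hp]
    simp only [h2, ← sum_filter, filter_mem_eq_inter, univ_inter]
    ring
  have hcs : (∑ p ∈ L, G p) ^ 2 ≤ #L * ((36 * (1 - 1 / 57600)) ^ t * #R) := by
    refine sq_sum_le_card_mul_sum_sq.trans (mul_le_mul_of_nonneg_left ?_ (by positivity))
    refine (sum_le_sum_of_subset_of_nonneg (subset_univ _) fun _ _ _ => sq_nonneg _).trans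
      ((sum_sq_sum_actWord_le hf0 t).trans (mul_le_mul_of_nonneg_left hf2 ?_))
    exact pow_nonneg (by norm_num) _
  have hroot : ∑ p ∈ L, G p ≤ 6 ^ t * (√(1 - 1 / 57600) ^ t * √(#L * #R)) := by
    refine le_of_sq_le_sq (hcs.trans (le_of_eq ?_)) (by positivity)
    have h1 : (√(1 - 1 / 57600) ^ t) ^ 2 = (1 - 1 / 57600 : ℝ) ^ t := by
      rw [← pow_mul, mul_comm, pow_mul, Real.sq_sqrt (by norm_num)]
    have h2 : ((6 : ℝ) ^ t) ^ 2 = 36 ^ t := by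
      rw [← pow_mul, mul_comm, pow_mul]
      norm_num
    rw [mul_pow, mul_pow, mul_pow, h1, h2, Real.sq_sqrt (by positivity)]
    ring
  rw [hedge]
  have : (6 : ℝ) ^ t * (#L * c) = 6 ^ t * ((#L : ℝ) * #R / N ^ 2) := by rw [hc]; ring
  linarith

end Torus

end BaseCode

/-! ### Propagation in expanding bipartite multigraphs. -/

namespace BaseCode

open Finset


theorem sum_card_fiber {E V : Type*} [Fintype E] [DecidableEq V] (l : E → V) (P : E → Prop) [DecidablePred P] (S : Finset V) :
    ∑ v ∈ S, #{e | l e = v ∧ P e} = #{e | l e ∈ S ∧ P e} := by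
  rw [card_eq_sum_card_fiberwise (f := l) (t := S) (fun e he => (mem_filter.1 he).2.1)]
  refine sum_congr rfl fun v hv => ?_
  rw [filter_filter]
  congr 1
  ext e
  simp only [mem_filter, mem_univ, true_and]
  constructor
  · rintro ⟨rfl, h⟩
    exact ⟨⟨hv, h⟩, rfl⟩
  · rintro ⟨⟨-, h⟩, rfl⟩
    exact ⟨rfl, h⟩

section Graph

variable {E V : Type*} [Fintype E] [DecidableEq V]

/-- Small pairs of vertex sets of an expanding bipartite multigraph lie in pairs of at most twice
the size to which no other vertex has many edges. -/
theorem exists_closed_pair [Fintype V] {l r : E → V} {D n μ β : ℝ} (hD : 0 < D) (hn : 0 < n) (hμ : 0 ≤ μ)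
    (hβ : 0 < β)
    (mix : ∀ L R : Finset V, (#{e | l e ∈ L ∧ r e ∈ R} : ℝ) ≤
      D * ((#L : ℝ) * #R / n + μ * √(#L * #R))) (L₀ R₀ : Finset V)
    (hk : ((#L₀ + #R₀ : ℕ) : ℝ) / n + μ < β) :
    ∃ L R : Finset V, L₀ ⊆ L ∧ R₀ ⊆ R ∧ #L + #R ≤ 2 * (#L₀ + #R₀) ∧
      (∀ v ∉ L, (#{e | l e = v ∧ r e ∈ R} : ℝ) < β * D) ∧
      ∀ u ∉ R, (#{e | r e = u ∧ l e ∈ L} : ℝ) < β * D := by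
  set k := #L₀ + #R₀ with hkdef
  rcases Nat.eq_zero_or_pos k with hk0 | hkpos
  · refine ⟨L₀, R₀, subset_rfl, subset_rfl, by omega, ?_⟩
    have hL : L₀ = ∅ := card_eq_zero.1 (by omega)
    have hR : R₀ = ∅ := card_eq_zero.1 (by omega)
    subst hL hR
    exact ⟨fun v _ => by simpa using mul_pos hβ hD, fun v _ => by simpa using mul_pos hβ hD⟩
  -- The pairs reachable by adding vertices that each bring at least `β * D` new edges, up to total
  -- size `2 * k`; a largest one is taken.
  · set F : Finset (Finset V × Finset V) := univ.filter fun p => L₀ ⊆ p.1 ∧ R₀ ⊆ p.2 ∧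
      #p.1 + #p.2 ≤ 2 * k ∧
      β * D * ((#p.1 : ℝ) + #p.2 - k) ≤ #{e | l e ∈ p.1 ∧ r e ∈ p.2} with hF
    have hne : F.Nonempty := ⟨(L₀, R₀), by
      simp only [hF, mem_filter, mem_univ, true_and]
      refine ⟨subset_rfl, subset_rfl, by omega, ?_⟩
      rw [hkdef]
      push_cast
      simp⟩
    obtain ⟨⟨L, R⟩, hmem, hmax⟩ := exists_max_image F (fun p => #p.1 + #p.2) hne
    simp only [hF, mem_filter, mem_univ, true_and] at hmem
    obtain ⟨hL, hR, hsize, hedge⟩ := hmem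
    have hkR : (0 : ℝ) < k := by exact_mod_cast hkpos
    -- A pair of size `2 * k` would span `β * D * k` edges, but mixing with `#L * #R ≤ k ^ 2` allows
    -- only `D * k * (k / n + μ)`. So there is room for one more vertex, and maximality means
    -- closedness.
    have hlt : #L + #R < 2 * k := by
      by_contra hcon
      have heq : #L + #R = 2 * k := by omega
      have heq' : (#L : ℝ) + #R = 2 * k := by exact_mod_cast heq
      have hprod : (#L : ℝ) * #R ≤ k ^ 2 := by nlinarith [sq_nonneg ((#L : ℝ) - #R)]
      have hsqrt : √((#L : ℝ) * #R) ≤ k := by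
        rw [← Real.sqrt_sq hkR.le]
        exact Real.sqrt_le_sqrt hprod
      have h1 := hedge.trans (mix L R)
      have h2 : D * ((#L : ℝ) * #R / n + μ * √(#L * #R)) ≤ D * (k ^ 2 / n + μ * k) := by
        gcongr
      have h3 : D * ((k : ℝ) ^ 2 / n + μ * k) = D * k * (k / n + μ) := by
        field_simp
      have h4 : D * k * ((k : ℝ) / n + μ) < D * k * β := by
        gcongr
      have h5 : β * D * ((#L : ℝ) + #R - k) = D * k * β := by
        rw [heq']
        ring
      linarith
    refine ⟨L, R, hL, hR, hsize, fun v hv => ?_, fun u hu => ?_⟩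
    · by_contra hcon
      have hins : #(insert v L) = #L + 1 := card_insert_of_notMem hv
      have hsplit : (#{e | l e ∈ insert v L ∧ r e ∈ R} : ℝ) =
          #{e | l e = v ∧ r e ∈ R} + #{e | l e ∈ L ∧ r e ∈ R} := by
        rw [← sum_card_fiber l (fun e => r e ∈ R) (insert v L), sum_insert hv, sum_card_fiber]
        push_cast
        rfl
      have := hmax (insert v L, R) (by
        simp only [hF, mem_filter, mem_univ, true_and]
        refine ⟨hL.trans (subset_insert _ _), hR, by omega, ?_⟩
        rw [hsplit, hins]
        push_cast
        linarith [not_lt.1 hcon])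
      simp only [hins] at this
      omega
    · by_contra hcon
      have hins : #(insert u R) = #R + 1 := card_insert_of_notMem hu
      have hsplit : (#{e | l e ∈ L ∧ r e ∈ insert u R} : ℝ) =
          #{e | r e = u ∧ l e ∈ L} + #{e | l e ∈ L ∧ r e ∈ R} := by
        simp only [and_comm (a := l _ ∈ L)]
        rw [← sum_card_fiber r (fun e => l e ∈ L) (insert u R), sum_insert hu, sum_card_fiber]
        push_cast
        rfl
      have := hmax (L, insert u R) (by
        simp only [hF, mem_filter, mem_univ, true_and]
        refine ⟨hL, hR.trans (subset_insert _ _), by omega, ?_⟩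
        rw [hsplit, hins]
        push_cast
        linarith [not_lt.1 hcon])
      simp only [hins] at this
      omega

/-- A vertex of `X` outside `L` has `2 * β * D` edges in `X`, of which fewer than `β * D` end in
`R`; the remaining ones end at other outside vertices of `X`. -/
theorem mul_card_le_of_degree [DecidableEq E] {l r : E → V} {D β : ℝ} {X : Finset E} {L R : Finset V}
    (hX : ∀ v ∉ L, (∀ e ∈ X, l e ≠ v) ∨ 2 * β * D ≤ #{e ∈ X | l e = v})
    (hL : ∀ v ∉ L, (#{e | l e = v ∧ r e ∈ R} : ℝ) < β * D) :
    β * D * #(X.image l \ L) ≤ #{e | l e ∈ X.image l \ L ∧ r e ∈ X.image r \ R} := by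
  rw [← sum_card_fiber, Nat.cast_sum, mul_comm, ← nsmul_eq_mul, ← sum_const]
  refine sum_le_sum fun v hv => ?_
  obtain ⟨hvX, hvL⟩ := mem_sdiff.1 hv
  obtain ⟨e₀, he₀, he₀v⟩ := mem_image.1 hvX
  rcases hX v hvL with h | h
  · exact absurd he₀v (h e₀ he₀)
  · have hsub : X.filter (fun e => l e = v) ⊆ univ.filter (fun e => l e = v ∧ r e ∈ R) ∪
        univ.filter (fun e => l e = v ∧ r e ∈ X.image r \ R) := by
      intro e he
      obtain ⟨heX, hev⟩ := mem_filter.1 he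
      by_cases hR : r e ∈ R
      · exact mem_union_left _ (by simp [hev, hR])
      · refine mem_union_right _ ?_
        simp only [mem_filter, mem_univ, true_and, mem_sdiff]
        exact ⟨hev, mem_image_of_mem _ heX, hR⟩
    have hcard : (#(X.filter (fun e => l e = v)) : ℝ) ≤ #{e | l e = v ∧ r e ∈ R} +
        #{e | l e = v ∧ r e ∈ X.image r \ R} := by
      exact_mod_cast (card_le_card hsub).trans (card_union_le _ _)
    have := hL v hvL
    linarith

/-- In an expanding bipartite multigraph, small edge sets that have large degree at every vertex
away from `A` stay close to `A`. -/
theorem exists_superset_of_expanding [Fintype V] [DecidableEq E] {l r : E → V} {D n μ β : ℝ} (hD : 0 < D) (hn : 0 < n)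
    (hμ : 0 ≤ μ) (hβ : 0 < β)
    (mix : ∀ L R : Finset V, (#{e | l e ∈ L ∧ r e ∈ R} : ℝ) ≤
      D * ((#L : ℝ) * #R / n + μ * √(#L * #R))) (hdeg : ∀ v, (#{e | l e = v} : ℝ) ≤ D)
    (A : Finset E) (hA : 2 * (#A : ℝ) / n + μ < β) :
    ∃ A' : Finset E, A ⊆ A' ∧ (#A' : ℝ) ≤ (1 + 4 * D) * #A ∧ ∀ X : Finset E,
      (#X : ℝ) / n + μ < β →
      (∀ v, (∀ e ∈ A, l e ≠ v) → (∀ e ∈ X, l e ≠ v) ∨ 2 * β * D ≤ #{e ∈ X | l e = v}) →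
      (∀ v, (∀ e ∈ A, r e ≠ v) → (∀ e ∈ X, r e ≠ v) ∨ 2 * β * D ≤ #{e ∈ X | r e = v}) →
      X ⊆ A' := by
  have hl0 : #(A.image l) ≤ #A := card_image_le
  have hr0 : #(A.image r) ≤ #A := card_image_le
  obtain ⟨L, R, hL, hR, hsize, hLc, hRc⟩ := exists_closed_pair hD hn hμ hβ mix (A.image l)
    (A.image r) (by
      refine lt_of_le_of_lt ?_ hA
      have : ((#(A.image l) + #(A.image r) : ℕ) : ℝ) ≤ 2 * #A := by
        exact_mod_cast (by omega : #(A.image l) + #(A.image r) ≤ 2 * #A)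
      gcongr)
  -- Closing up gives `#L ≤ 4 * #A`, and each vertex of `L` has at most `D` edges.
  refine ⟨A ∪ univ.filter (fun e => l e ∈ L), subset_union_left, ?_, fun X hX hXl hXr => ?_⟩
  · have h1 : (#(univ.filter (fun e => l e ∈ L)) : ℝ) ≤ #L * D := by
      have := sum_card_fiber l (fun _ => True) L
      simp only [and_true] at this
      rw [← this, Nat.cast_sum, ← nsmul_eq_mul, ← sum_const]
      exact sum_le_sum fun v _ => hdeg v
    have h2 : (#L : ℝ) ≤ 4 * #A := by
      exact_mod_cast (by omega : #L ≤ 4 * #A)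
    have h3 : (#(A ∪ univ.filter (fun e => l e ∈ L)) : ℝ) ≤
        #A + #(univ.filter (fun e => l e ∈ L)) := by exact_mod_cast card_union_le _ _
    nlinarith
  · have hXl' : ∀ v ∉ L, (∀ e ∈ X, l e ≠ v) ∨ 2 * β * D ≤ #{e ∈ X | l e = v} := fun v hv =>
      hXl v fun e he h => hv (hL (h ▸ mem_image_of_mem l he))
    have hXr' : ∀ v ∉ R, (∀ e ∈ X, r e ≠ v) ∨ 2 * β * D ≤ #{e ∈ X | r e = v} := fun v hv =>
      hXr v fun e he h => hv (hR (h ▸ mem_image_of_mem r he))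
    have e1 := mul_card_le_of_degree hXl' hLc
    have e2 := mul_card_le_of_degree hXr' hRc
    simp only [and_comm (a := r _ ∈ _)] at e2
    have hmix := mix (X.image l \ L) (X.image r \ R)
    have ha : (#(X.image l \ L) : ℝ) ≤ #X := by
      exact_mod_cast (card_le_card sdiff_subset).trans card_image_le
    have hb : (#(X.image r \ R) : ℝ) ≤ #X := by
      exact_mod_cast (card_le_card sdiff_subset).trans card_image_le
    -- With `p = √(a * b) ≤ max a b`, the degree bounds and mixing give `β * p ≤ (p / n + μ) * p`.
    -- Since `p ≤ #X`, this forces `p = 0`, and then `β * a ≤ 0`.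
    have hempty : #(X.image l \ L) = 0 := by
      set a : ℝ := ((#(X.image l \ L) : ℕ) : ℝ)
      set b : ℝ := ((#(X.image r \ R) : ℕ) : ℝ)
      have ha0 : 0 ≤ a := by positivity
      have hb0 : 0 ≤ b := by positivity
      set p := √(a * b) with hp
      have hp0 : 0 ≤ p := Real.sqrt_nonneg _
      have hpsq : p ^ 2 = a * b := Real.sq_sqrt (by positivity)
      have f1 : β * a ≤ a * b / n + μ * p := by
        refine le_of_mul_le_mul_left ?_ hD
        linarith
      have f2 : β * b ≤ a * b / n + μ * p := by
        refine le_of_mul_le_mul_left ?_ hD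
        linarith
      have hpX : p ≤ #X := by
        rw [hp, ← Real.sqrt_sq (by positivity : (0 : ℝ) ≤ #X), sq]
        exact Real.sqrt_le_sqrt (mul_le_mul ha hb hb0 (by positivity))
      have hpmax : p ≤ max a b := by
        rw [hp, ← Real.sqrt_sq (ha0.trans (le_max_left a b)), sq]
        exact Real.sqrt_le_sqrt (mul_le_mul (le_max_left _ _) (le_max_right _ _) hb0
          (ha0.trans (le_max_left a b)))
      have hβp : β * p ≤ p ^ 2 / n + μ * p := by
        rw [hpsq]
        refine (mul_le_mul_of_nonneg_left hpmax hβ.le).trans ?_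
        rcases max_choice a b with h | h <;> rw [h] <;> assumption
      have hpz : p = 0 := by
        by_contra hne
        have hppos : 0 < p := lt_of_le_of_ne hp0 (Ne.symm hne)
        have : β * p ≤ (p / n + μ) * p := hβp.trans (le_of_eq (by ring))
        have h1 := le_of_mul_le_mul_right this hppos
        have h2 : p / n ≤ #X / n := by gcongr
        linarith
      have hab : a * b = 0 := by rw [← hpsq, hpz]; ring
      rw [hab, hpz, zero_div, mul_zero, add_zero] at f1
      have haz : a = 0 := by nlinarith
      exact Nat.cast_eq_zero.1 haz
    intro e he
    refine mem_union_right _ (mem_filter.2 ⟨mem_univ _, ?_⟩)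
    by_contra hcon
    have : l e ∈ X.image l \ L := mem_sdiff.2 ⟨mem_image_of_mem l he, hcon⟩
    rw [card_eq_zero] at hempty
    simp [hempty] at this

end Graph

end BaseCode

/-! ### The Gilbert–Varshamov bound. -/

namespace BaseCode

open Finset

/-- The number of binary words of weight less than `d`. -/
theorem card_ball_le (D d : ℕ) :
    #{y : Fin D → ZMod 2 | hammingNorm y < d} ≤ (D + 1) ^ d := by
  classical
  let supp : (Fin D → ZMod 2) → Finset (Fin D) := fun y => univ.filter fun k => y k ≠ 0
  -- A word is encoded by listing its support, padded with `none` to length `d`.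
  let code : (Fin D → ZMod 2) → Fin d → Option (Fin D) := fun y i => (supp y).toList[(i : ℕ)]?
  have hcard : #(univ : Finset (Fin d → Option (Fin D))) = (D + 1) ^ d := by simp
  rw [← hcard]
  refine card_le_card_of_injOn code (fun _ _ => mem_coe.2 (mem_univ _)) ?_
  have hmem : ∀ y : Fin D → ZMod 2, hammingNorm y < d → ∀ k, y k ≠ 0 ↔ ∃ i, code y i = some k := by
    intro y hy k
    have hk : y k ≠ 0 ↔ k ∈ (supp y).toList := by simp [supp]
    rw [hk, List.mem_iff_getElem?]
    constructor
    · rintro ⟨i, hi⟩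
      have : i < (supp y).toList.length := (List.getElem?_eq_some_iff.1 hi).1
      rw [length_toList] at this
      exact ⟨⟨i, this.trans hy⟩, hi⟩
    · rintro ⟨i, hi⟩
      exact ⟨i, hi⟩
  have htwo : ∀ a b : ZMod 2, (a ≠ 0 ↔ b ≠ 0) → a = b := by decide
  intro y hy z hz hyz
  funext k
  refine htwo _ _ ?_
  rw [hmem y (by simpa using hy), hmem z (by simpa using hz), hyz]

/-- **Gilbert–Varshamov**: there are check matrices with few rows whose kernel has large minimum
distance. -/
theorem exists_checks (D d : ℕ) (hd : 0 < d) :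
    ∃ (m : ℕ) (H : Matrix (Fin m) (Fin D) (ZMod 2)), 2 ^ m ≤ (D + 1) ^ d ∧
      ∀ y, H.mulVec y = 0 → y ≠ 0 → d ≤ hammingNorm y := by
  classical
  let good : Submodule (ZMod 2) (Fin D → ZMod 2) → Prop := fun C =>
    ∀ c ∈ C, c ≠ 0 → d ≤ hammingNorm c
  have hbot : good ⊥ := fun c hc h => absurd ((Submodule.mem_bot _).1 hc) h
  obtain ⟨C, hC, hmax⟩ : ∃ C, good C ∧ ∀ C', good C' →
      Module.finrank (ZMod 2) C' ≤ Module.finrank (ZMod 2) C := by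
    obtain ⟨C, hC, hmax⟩ := exists_max_image
      ((Set.toFinite {C : Submodule (ZMod 2) (Fin D → ZMod 2) | good C}).toFinset)
      (fun C => Module.finrank (ZMod 2) C) ⟨⊥, by simpa using hbot⟩
    exact ⟨C, by simpa using hC, fun C' h => hmax C' (by simpa using h)⟩
  -- A word at distance at least `d` from all of `C` could be adjoined, contradicting maximal
  -- dimension.
  have hcover : ∀ v, ∃ c ∈ C, hammingNorm (v - c) < d := by
    by_contra hcon
    push Not at hcon
    obtain ⟨v, hv⟩ := hcon
    have hvC : v ∉ C := fun h => by
      have := hv v h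
      simp at this
      omega
    have hlt : C < C ⊔ Submodule.span (ZMod 2) {v} := by
      refine lt_of_le_of_ne le_sup_left fun h => hvC ?_
      rw [h]
      exact Submodule.mem_sup_right (Submodule.mem_span_singleton_self v)
    refine absurd (hmax (C ⊔ Submodule.span (ZMod 2) {v}) ?_)
      (not_le.2 (Submodule.finrank_lt_finrank_of_lt hlt))
    intro x hx hx0
    obtain ⟨c, hc, w, hw, rfl⟩ := Submodule.mem_sup.1 hx
    obtain ⟨a, rfl⟩ := Submodule.mem_span_singleton.1 hw
    have ha : a = 0 ∨ a = 1 := (by decide : ∀ a : ZMod 2, a = 0 ∨ a = 1) a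
    rcases ha with rfl | rfl
    · simp only [zero_smul, add_zero] at hx0 ⊢
      exact hC c hc hx0
    · have := hv (-c) (C.neg_mem hc)
      rwa [sub_neg_eq_add, add_comm, ← one_smul (ZMod 2) v] at this
  have hcardC : Fintype.card C = 2 ^ Module.finrank (ZMod 2) C := by
    rw [Module.card_eq_pow_finrank (K := ZMod 2), ZMod.card]
  have hcount : 2 ^ D ≤ 2 ^ Module.finrank (ZMod 2) C * (D + 1) ^ d := by
    choose c hc hcv using hcover
    have hinj : Function.Injective (fun v => ((⟨c v, hc v⟩ : C), v - c v)) := by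
      intro v w h
      simp only [Prod.mk.injEq, Subtype.mk.injEq] at h
      have := h.2
      rw [h.1] at this
      exact sub_left_injective this
    have h1 : #(univ : Finset (Fin D → ZMod 2)) ≤
        #((univ : Finset C) ×ˢ ({y : Fin D → ZMod 2 | hammingNorm y < d} : Finset _)) :=
      card_le_card_of_injOn _ (fun v _ => by simpa using hcv v) hinj.injOn
    rw [card_product, card_univ, card_univ, hcardC] at h1
    have h2 : Fintype.card (Fin D → ZMod 2) = 2 ^ D := by simp
    rw [h2] at h1
    exact h1.trans (Nat.mul_le_mul_left _ (card_ball_le D d))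
  have hrank := C.finrank_quotient_add_finrank
  rw [Module.finrank_fin_fun] at hrank
  -- The quotient map serves as check matrix, so the number of rows is exactly the codimension.
  let e := (Module.finBasis (ZMod 2) ((Fin D → ZMod 2) ⧸ C)).equivFun
  refine ⟨_, LinearMap.toMatrix' (e.toLinearMap ∘ₗ C.mkQ), ?_, fun y hy => hC y ?_⟩
  · refine le_of_mul_le_mul_left ?_ (pow_pos (by norm_num : 0 < 2) (Module.finrank (ZMod 2) C))
    rw [← pow_add, add_comm, hrank]
    exact hcount
  · rw [← Matrix.toLin'_apply, Matrix.toLin'_toMatrix'] at hy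
    simpa using hy

end BaseCode

/-! ### Tanner codes on the torus and the choice of the inner code. -/

namespace BaseCode

open Finset StackProgram

theorem point_injective {N : ℕ} [NeZero N] :
    Function.Injective fun p : Fin N × Fin N => point p.1 p.2 := by
  intro p q h
  simp only [point, Prod.mk.injEq] at h
  refine Prod.ext (Fin.ext ?_) (Fin.ext ?_)
  · have := congrArg ZMod.val h.1
    rwa [ZMod.val_cast_of_lt p.1.2, ZMod.val_cast_of_lt q.1.2] at this
  · have := congrArg ZMod.val h.2
    rwa [ZMod.val_cast_of_lt p.2.2, ZMod.val_cast_of_lt q.2.2] at this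

/-- The points of the torus, enumerated by pairs of coordinates. -/
noncomputable def pointEquiv (N : ℕ) [NeZero N] : Fin N × Fin N ≃ ZMod N × ZMod N :=
  Equiv.ofBijective (fun p => point p.1 p.2)
    ((Fintype.bijective_iff_injective_and_card _).2 ⟨point_injective, by simp⟩)

/-- The word with a given number. -/
def word {t : ℕ} (s : Fin (6 ^ t)) : List (Fin 6) := List.ofFn (finFunctionFinEquiv.symm s)

/-- A word acts as a permutation of the torus. -/
noncomputable def actWordEquiv (N : ℕ) [NeZero N] (w : List (Fin 6)) :
    ZMod N × ZMod N ≃ ZMod N × ZMod N :=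
  Equiv.ofBijective (actWord w) (by
    induction w with
    | nil => exact Function.bijective_id
    | cons g w ih => exact ih.comp (actEquiv N g).bijective)

/-- The columns of a check matrix as edges, given by their left end and their word. -/
noncomputable def leftEquiv (N t : ℕ) [NeZero N] :
    Fin (N * (N * 6 ^ t)) ≃ (ZMod N × ZMod N) × Fin (6 ^ t) :=
  ((tripleEquiv N (6 ^ t)).symm.trans (Equiv.prodAssoc _ _ _).symm).trans
    ((pointEquiv N).prodCongr (Equiv.refl _))

/-- The columns of a check matrix as edges, given by their right end and their word. -/
noncomputable def rightEquiv (N t : ℕ) [NeZero N] :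
    Fin (N * (N * 6 ^ t)) ≃ (ZMod N × ZMod N) × Fin (6 ^ t) :=
  (leftEquiv N t).trans (((Equiv.prodComm _ _).trans
    (Equiv.prodShear (Equiv.refl _) fun s => actWordEquiv N (word s))).trans (Equiv.prodComm _ _))

/-- The bits around `v` form a word of the inner code, which is zero or has weight at least `d`. -/
theorem degree_of_checks {E V W : Type*} [Fintype E] [Fintype V] [DecidableEq V] [Fintype W]
    (Φ : E ≃ V × W) {m d : ℕ} {H₀ : Matrix (Fin m) W (ZMod 2)}
    (hH₀ : ∀ y, H₀.mulVec y = 0 → y ≠ 0 → d ≤ hammingNorm y) (x : E → ZMod 2) (v : V)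
    (hx : ∀ j, ∑ e, (if (Φ e).1 = v then H₀ j (Φ e).2 else 0) * x e = 0) :
    (∀ e ∈ univ.filter (fun e => x e ≠ 0), (Φ e).1 ≠ v) ∨
      d ≤ #{e ∈ univ.filter (fun e => x e ≠ 0) | (Φ e).1 = v} := by
  classical
  by_cases hy : (fun s => x (Φ.symm (v, s))) = 0
  · refine Or.inl fun e he hev => (mem_filter.1 he).2 ?_
    have := congrFun hy (Φ e).2
    rwa [← hev, Prod.mk.eta, Equiv.symm_apply_apply] at this
  · refine Or.inr ((hH₀ _ ?_ hy).trans ?_)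
    · funext j
      change ∑ s, H₀ j s * x (Φ.symm (v, s)) = 0
      rw [← hx j, ← Φ.symm.sum_comp, Fintype.sum_prod_type]
      simp only [Equiv.apply_symm_apply]
      rw [sum_eq_single v]
      · simp
      · intro u _ hu
        simp [hu]
      · simp
    · refine card_le_card_of_injOn (fun s => Φ.symm (v, s)) (fun s hs => ?_) fun s _ s' _ h => ?_
      · simpa using hs
      · simpa using h

section Tanner

variable {t m : ℕ} (H₀ : Matrix (Fin m) (Fin (6 ^ t)) (ZMod 2))

/-- The words of the checks: left checks compare left ends, right checks compare right ends. -/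
def checkWord (l : Fin (m + m)) (s : Fin (6 ^ t)) : List (Fin 6) :=
  Sum.elim (fun _ => []) (fun _ => word s) (finSumFinEquiv.symm l)

/-- The entries of the checks. -/
def checkEntry (l : Fin (m + m)) (s : Fin (6 ^ t)) : ZMod 2 :=
  H₀ (Sum.elim id id (finSumFinEquiv.symm l)) s

/-- The check matrix of the Tanner code of the action of the words of length `t` on the torus with
inner check matrix `H₀`. -/
def tannerMatrix (N : ℕ) :
    Matrix (Fin (N * (N * (m + m)))) (Fin (N * (N * 6 ^ t))) (ZMod 2) :=
  checkMatrix checkWord (checkEntry H₀) N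

variable {N : ℕ} [NeZero N]

theorem tannerMatrix_left (p : Fin N × Fin N) (j : Fin m) (e : Fin (N * (N * 6 ^ t))) :
    tannerMatrix H₀ N (tripleEquiv _ _ (p.1, p.2, finSumFinEquiv (Sum.inl j))) e =
      if (leftEquiv N t e).1 = pointEquiv N p then H₀ j (leftEquiv N t e).2 else 0 := by
  simp only [tannerMatrix, checkMatrix, Equiv.symm_apply_apply, checkWord, checkEntry,
    Sum.elim_inl, id]
  rfl

theorem tannerMatrix_right (p : Fin N × Fin N) (j : Fin m) (e : Fin (N * (N * 6 ^ t))) :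
    tannerMatrix H₀ N (tripleEquiv _ _ (p.1, p.2, finSumFinEquiv (Sum.inr j))) e =
      if (rightEquiv N t e).1 = pointEquiv N p then H₀ j (rightEquiv N t e).2 else 0 := by
  simp only [tannerMatrix, checkMatrix, Equiv.symm_apply_apply, checkWord, checkEntry,
    Sum.elim_inr, id]
  rfl

theorem card_fst_eq {E V W : Type*} [Fintype E] [DecidableEq V] [Fintype W] (Φ : E ≃ V × W)
    (v : V) : #{e | (Φ e).1 = v} ≤ Fintype.card W := by
  refine card_le_card_of_injOn (t := univ) (fun e => (Φ e).2) (fun _ _ => by simp)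
    fun e he e' he' h => Φ.injective (Prod.ext ?_ h)
  simp only [coe_filter, mem_univ, true_and, Set.mem_ofPred_eq] at he he'
  rw [he, he']

/-- A check sees only the edges at one vertex, so the density bound does not depend on `N`. -/
theorem card_tannerMatrix_row_le (u : Fin (N * (N * (m + m)))) :
    #{e | tannerMatrix H₀ N u e ≠ 0} ≤ 6 ^ t := by
  obtain ⟨⟨a, b, l⟩, rfl⟩ := (tripleEquiv N (m + m)).surjective u
  obtain ⟨l, rfl⟩ := finSumFinEquiv.surjective l
  rcases l with j | j
  · refine (card_le_card fun e he => ?_).trans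
      ((card_fst_eq (leftEquiv N t) (pointEquiv N (a, b))).trans (by simp))
    rw [mem_filter, tannerMatrix_left H₀ (a, b)] at he
    simp only [mem_filter, mem_univ, true_and]
    by_contra hcon
    simp [hcon] at he
  · refine (card_le_card fun e he => ?_).trans
      ((card_fst_eq (rightEquiv N t) (pointEquiv N (a, b))).trans (by simp))
    rw [mem_filter, tannerMatrix_right H₀ (a, b)] at he
    simp only [mem_filter, mem_univ, true_and]
    by_contra hcon
    simp [hcon] at he

theorem card_tanner_edges_le (L R : Finset (ZMod N × ZMod N)) :
    (#{e | (leftEquiv N t e).1 ∈ L ∧ (rightEquiv N t e).1 ∈ R} : ℝ) ≤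
      ((6 ^ t : ℕ) : ℝ) * ((#L : ℝ) * #R / (N : ℝ) ^ 2 + √(1 - 1 / 57600) ^ t * √(#L * #R)) := by
  have h := card_edges_le t L R
  have e : #{e | (leftEquiv N t e).1 ∈ L ∧ (rightEquiv N t e).1 ∈ R} =
      #{e : (ZMod N × ZMod N) × (Fin t → Fin 6) | e.1 ∈ L ∧ actWord (List.ofFn e.2) e.1 ∈ R} := by
    refine card_equiv ((leftEquiv N t).trans
      ((Equiv.refl _).prodCongr finFunctionFinEquiv.symm)) fun e => ?_
    simp only [mem_filter, mem_univ, true_and]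
    rfl
  rw [e]
  push_cast
  exact h

/-- Tanner codes on the torus are smooth. -/
theorem isSmooth_tannerMatrix {β : ℝ} {d : ℕ} (hβ : √(1 - 1 / 57600) ^ t < β)
    (hd : 2 * β * (6 : ℝ) ^ t ≤ d)
    (hH₀ : ∀ y, H₀.mulVec y = 0 → y ≠ 0 → d ≤ hammingNorm y) :
    IsSmooth (tannerMatrix H₀ N) ((β - √(1 - 1 / 57600) ^ t) / (4 * 6 ^ t)) (1 + 4 * 6 ^ t)
      ((β - √(1 - 1 / 57600) ^ t) / (4 * 6 ^ t)) := by
  set μ : ℝ := √(1 - 1 / 57600) ^ t with hμ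
  have hμ0 : 0 ≤ μ := by positivity
  have hN : (0 : ℝ) < N := by exact_mod_cast NeZero.pos N
  have hD : ((6 ^ t : ℕ) : ℝ) = 6 ^ t := by push_cast; rfl
  have hD0 : (0 : ℝ) < 6 ^ t := by positivity
  have hr : ((N * (N * 6 ^ t) : ℕ) : ℝ) = N ^ 2 * 6 ^ t := by push_cast; ring
  -- The factor `4` absorbs the `2` of the expansion hypothesis and leaves half of `β - μ` for
  -- strictness.
  have hsmall : ∀ a : ℝ, a ≤ (β - μ) / (4 * 6 ^ t) * (N * (N * 6 ^ t) : ℕ) →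
      2 * a / N ^ 2 + μ < β := by
    intro a ha
    rw [hr] at ha
    have e : (β - μ) / (4 * 6 ^ t) * ((N : ℝ) ^ 2 * 6 ^ t) = (β - μ) / 4 * N ^ 2 := by
      field_simp
    rw [e] at ha
    have : 2 * a / (N : ℝ) ^ 2 ≤ (β - μ) / 2 := by
      rw [div_le_iff₀ (by positivity)]
      linarith
    linarith
  intro A hA
  obtain ⟨A', hAA', hA', hX⟩ := exists_superset_of_expanding (l := fun e => (leftEquiv N t e).1)
    (r := fun e => (rightEquiv N t e).1) (D := 6 ^ t) (n := (N : ℝ) ^ 2) hD0 (by positivity) hμ0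
    (hμ0.trans_lt hβ) (fun L R => by rw [← hD]; exact card_tanner_edges_le L R)
    (fun v => by
      rw [← hD]
      exact_mod_cast (card_fst_eq (leftEquiv N t) v).trans (by simp)) A (hsmall _ hA)
  refine ⟨A', hAA', hA', fun x hx hcheck v hv => ?_⟩
  by_contra hxv
  refine hv (hX (univ.filter fun e => x e ≠ 0) ?_ ?_ ?_ (by simpa using hxv))
  · have h1 : ((#(univ.filter fun e => x e ≠ 0) : ℕ) : ℝ) ≤
        (β - μ) / (4 * 6 ^ t) * (N * (N * 6 ^ t) : ℕ) := hx
    refine lt_of_le_of_lt ?_ (hsmall _ h1)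
    gcongr
    linarith [Nat.cast_nonneg (α := ℝ) (#(univ.filter fun e => x e ≠ 0))]
  -- No edge of `A` ends at `u`, so all checks at `u` avoid `A` and are still available.
  · intro u hu
    obtain ⟨p, rfl⟩ := (pointEquiv N).surjective u
    refine (degree_of_checks (leftEquiv N t) hH₀ x (pointEquiv N p) fun j => ?_).imp id
      fun h => hd.trans (by exact_mod_cast h)
    have := hcheck (tripleEquiv _ _ (p.1, p.2, finSumFinEquiv (Sum.inl j))) fun a ha => by
      rw [tannerMatrix_left, if_neg (hu a ha)]
    simpa only [tannerMatrix_left] using this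
  · intro u hu
    obtain ⟨p, rfl⟩ := (pointEquiv N).surjective u
    refine (degree_of_checks (rightEquiv N t) hH₀ x (pointEquiv N p) fun j => ?_).imp id
      fun h => hd.trans (by exact_mod_cast h)
    have := hcheck (tripleEquiv _ _ (p.1, p.2, finSumFinEquiv (Sum.inr j))) fun a ha => by
      rw [tannerMatrix_right, if_neg (hu a ha)]
    simpa only [tannerMatrix_right] using this

end Tanner

theorem sub_le_finrank_ker {m r : ℕ} (H : Matrix (Fin m) (Fin r) (ZMod 2)) :
    r ≤ Module.finrank (ZMod 2) (LinearMap.ker H.mulVecLin) + m := by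
  have h := LinearMap.finrank_range_add_finrank_ker H.mulVecLin
  have h' := (LinearMap.range H.mulVecLin).finrank_le
  rw [Module.finrank_fin_fun] at h h'
  omega

/-- Parameters for the inner code: large words length makes the expansion beat the redundancy. -/
theorem exists_word_length {ε μ : ℝ} (hε : 0 < ε) (hμ0 : 0 < μ) (hμ1 : μ < 1) :
    ∃ t : ℕ, 1 ≤ t ∧ 24 * (t * μ ^ t) + 6 * (t * (1 / 6) ^ t) ≤ ε := by
  have h1 := tendsto_self_mul_const_pow_of_lt_one hμ0.le hμ1
  have h2 := tendsto_self_mul_const_pow_of_lt_one (r := (1 / 6 : ℝ)) (by norm_num) (by norm_num)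
  have h := (h1.const_mul 24).add (h2.const_mul 6)
  simp only [mul_zero, add_zero] at h
  obtain ⟨t, ht, ht'⟩ := ((h.eventually (ge_mem_nhds hε)).and (Filter.eventually_ge_atTop 1)).exists
  exact ⟨t, ht', ht⟩

/-- The inner code. -/
theorem exists_inner_checks {ε : ℝ} (hε : 0 < ε) :
    ∃ (t m d : ℕ) (H₀ : Matrix (Fin m) (Fin (6 ^ t)) (ZMod 2)), 1 ≤ t ∧
      2 * (m : ℝ) ≤ ε * 6 ^ t ∧ 2 * (2 * √(1 - 1 / 57600) ^ t) * (6 : ℝ) ^ t ≤ d ∧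
      ∀ y, H₀.mulVec y = 0 → y ≠ 0 → d ≤ hammingNorm y := by
  set μ : ℝ := √(1 - 1 / 57600) with hμ
  have hμ0 : 0 < μ := Real.sqrt_pos.2 (by norm_num)
  have hμ1 : μ < 1 := by
    rw [hμ, Real.sqrt_lt' one_pos]
    norm_num
  obtain ⟨t, ht1, ht⟩ := exists_word_length hε hμ0 hμ1
  have hD0 : (0 : ℝ) < 6 ^ t := by positivity
  -- The degree threshold `2 * β * D` for `β = 2 * μ ^ t`, twice the expansion defect.
  set d := ⌈2 * (2 * μ ^ t) * (6 : ℝ) ^ t⌉₊ with hd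
  have hd0 : 0 < d := Nat.ceil_pos.2 (by positivity)
  obtain ⟨m, H₀, hm, hH₀⟩ := exists_checks (6 ^ t) d hd0
  refine ⟨t, m, d, H₀, ht1, ?_, Nat.le_ceil _, hH₀⟩
  -- From `2 ^ m ≤ (6 ^ t + 1) ^ d ≤ 8 ^ (t * d)`.
  have hm' : m ≤ 3 * t * d := by
    have h8 : 6 ^ t + 1 ≤ 8 ^ t := by
      have : 6 ^ t < 8 ^ t := Nat.pow_lt_pow_left (by norm_num) (by omega)
      omega
    have : 2 ^ m ≤ 2 ^ (3 * t * d) := by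
      refine hm.trans ((Nat.pow_le_pow_left h8 d).trans (le_of_eq ?_))
      rw [pow_mul, pow_mul]
      norm_num
    exact (Nat.pow_le_pow_iff_right (by norm_num)).1 this
  have hd' : (d : ℝ) ≤ 2 * (2 * μ ^ t) * 6 ^ t + 1 := (Nat.ceil_lt_add_one (by positivity)).le
  have hm'' : (m : ℝ) ≤ 3 * t * d := by exact_mod_cast hm'
  have h1 : 2 * (m : ℝ) ≤ 6 * t * (2 * (2 * μ ^ t) * 6 ^ t + 1) := by
    have := mul_le_mul_of_nonneg_left hd' (by positivity : (0 : ℝ) ≤ 6 * t)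
    linarith
  have h2 := mul_le_mul_of_nonneg_right ht hD0.le
  have h3 : (1 / 6 : ℝ) ^ t * 6 ^ t = 1 := by
    rw [← mul_pow]
    norm_num
  have h4 : (24 * (t * μ ^ t) + 6 * (t * (1 / 6 : ℝ) ^ t)) * 6 ^ t =
      6 * t * (2 * (2 * μ ^ t) * 6 ^ t + 1) := by
    linear_combination 6 * (t : ℝ) * h3
  linarith

end BaseCode

/-! ### Assembly. -/

theorem proposition3p7 (ε : ℝ) (hε : 0 < ε) :
    ∃ δ₁ : ℝ, 0 < δ₁ ∧ ∃ σ₁ : ℝ, 0 < σ₁ ∧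
      ∃ (r : ℕ → ℕ) (C : ∀ i, BaseCode.LinearCode (r i)),
        BaseCode.ExplicitlyConstructed r C ∧
        (∀ i, Even (r i)) ∧
        Filter.Tendsto r Filter.atTop Filter.atTop ∧
        ∀ i, 1 - ε ≤ BaseCode.rate (C i) ∧
          δ₁ ≤ BaseCode.normDist (C i) ∧
          σ₁ ≤ BaseCode.agreementTestability (C i) := by
  -- Capping `ε` at `1 / 2` keeps the rate positive, so that the codes are nonzero.
  have hε' : 0 < min ε (1 / 2) := lt_min hε (by norm_num)
  obtain ⟨t, m, d, H₀, ht, hm, hd, hH₀⟩ := BaseCode.exists_inner_checks hε'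
  have hμ0 : 0 < √(1 - 1 / 57600 : ℝ) ^ t := pow_pos (Real.sqrt_pos.2 (by norm_num)) t
  have hsmooth := fun i : ℕ => BaseCode.isSmooth_tannerMatrix H₀ (N := i + 1) (d := d)
    (by linarith : √(1 - 1 / 57600 : ℝ) ^ t < 2 * √(1 - 1 / 57600 : ℝ) ^ t) hd hH₀
  set κ : ℝ := (2 * √(1 - 1 / 57600 : ℝ) ^ t - √(1 - 1 / 57600 : ℝ) ^ t) / (4 * 6 ^ t) with hκ
  have hκ0 : 0 < κ := div_pos (by linarith) (by positivity)
  have hD0 : 0 < 6 ^ t := pow_pos (by norm_num) t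
  have hDR : (0 : ℝ) < (6 : ℝ) ^ t := by positivity
  have hr : ∀ i : ℕ, 0 < (i + 1) * ((i + 1) * 6 ^ t) := fun i => by positivity
  set C : ∀ i : ℕ, BaseCode.LinearCode ((i + 1) * ((i + 1) * 6 ^ t)) := fun i =>
    LinearMap.ker (BaseCode.tannerMatrix H₀ (i + 1)).mulVecLin with hC
  have hmem : ∀ i x, x ∈ C i ↔ (BaseCode.tannerMatrix H₀ (i + 1)).mulVec x = 0 := fun i x => by
    simp [hC]
  -- There are `2 * m` checks per point of the torus against `6 ^ t` bits.
  have hrate : ∀ i, 1 - min ε (1 / 2) ≤ BaseCode.rate (C i) := fun i => by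
    have h := BaseCode.sub_le_finrank_ker (BaseCode.tannerMatrix H₀ (i + 1))
    have h' : (((i + 1) * ((i + 1) * 6 ^ t) : ℕ) : ℝ) ≤
        Module.finrank (ZMod 2) (C i) + ((i + 1) * ((i + 1) * (m + m)) : ℕ) := by exact_mod_cast h
    rw [BaseCode.rate, le_div_iff₀ (by exact_mod_cast hr i)]
    push_cast at h' ⊢
    have := mul_le_mul_of_nonneg_left hm (by positivity : (0 : ℝ) ≤ ((i : ℝ) + 1) * (i + 1))
    linarith
  have hne : ∀ i, C i ≠ ⊥ := fun i h => by
    have := hrate i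
    rw [h, BaseCode.rate, finrank_bot] at this
    have := min_le_right ε (1 / 2)
    norm_num at *
  refine ⟨κ, hκ0, min (min (κ / (6 ^ t : ℕ) * κ) (κ / (6 ^ t : ℕ) * κ / (1 + 4 * 6 ^ t)))
    (κ / (6 ^ t : ℕ) / (1 + 4 * 6 ^ t)), ?_, fun i => (i + 1) * ((i + 1) * 6 ^ t), C, ?_, ?_, ?_, ?_⟩
  · push_cast
    refine lt_min (lt_min ?_ ?_) ?_ <;> positivity
  · exact ⟨fun i => (i + 1) * ((i + 1) * (m + m)), fun i => BaseCode.tannerMatrix H₀ (i + 1), hmem,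
      StackProgram.exists_computer_checkMatrix hD0 _ _⟩
  · intro i
    -- Having six maps, with the identity listed twice, makes the degree even; `1 ≤ t` is needed.
    have : Even (6 ^ t) := Nat.even_pow.2 ⟨by decide, by omega⟩
    exact (this.mul_left _).mul_left _
  · refine Filter.tendsto_atTop_mono (fun i => ?_) Filter.tendsto_id
    calc i ≤ (i + 1) * 1 := by omega
      _ ≤ (i + 1) * ((i + 1) * 6 ^ t) := Nat.mul_le_mul_left _ (Nat.mul_pos (by omega) hD0)
  · intro i
    refine ⟨le_trans (by linarith [min_le_left ε (1 / 2)]) (hrate i),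
      (hsmooth i).le_normDist hκ0.le (hmem i) (hne i) (hr i),
      (hsmooth i).le_agreementTestability (hmem i) (hne i) (hr i)
        (BaseCode.card_tannerMatrix_row_le H₀) hD0 hκ0 (by positivity) hκ0⟩
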